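/- **Area law for Krein-gapped quadratic bosonic Hamiltonians (case $H_{xp}+H_{xp}^T=0$).** Let $D\ge 1$, let $|\cdot|$ be the $\ell^1$ (lattice path) length on $\mathbb Z^D$, and consider a translationally invariant single-band quadratic bosonic Hamiltonian (one boson per site) $$H=\sum_{j,r\in\mathbb Z^D}K_r\,a_j^\dagger a_{j+r}+\tfrac12\big(\Delta_r\,a_j^\dagger a_{j+r}^\dagger+\mathrm{h.c.}\big),\qquad K_{-r}=\overline{K_r},\quad \Delta_{-r}=\Delta_r,$$ with finite range $R\ge1$ ($K_r=\Delta_r=0$ for $|r|>R$). In quadratures its couplings are the matrices $(H_{xx})_{j,j+r}=\mathrm{Re}(K_r+\Delta_r)$, $(H_{pp})_{j,j+r}=\mathrm{Re}(K_r-\Delta_r)$, $(H_{xp})_{j,j+r}=\mathrm{Im}(\Delta_r-K_r)$; let $X(k),P(k)$ be the symbols $\sum_r e^{ik\cdot r}(\cdot)_{0,r}$ of $H_{xx},H_{pp}$, and $\|H_{xx}\|=\sup_k|X(k)|$, $\|H_{pp}\|=\sup_k|P(k)|$ their operator norms on $\ell^2(\mathbb Z^D)$. Put $K(k)=\sum_r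 e^{ik\cdot r}K_r$, $\Delta(k)=\sum_r e^{ik\cdot r}\Delta_r$, $$g(k)=\begin{pmatrix}K(k)&\Delta(k)\\-\overline{\Delta(-k)}&-\overline{K(-k)}\end{pmatrix},\qquad \tau_3=\begin{pmatrix}1&0\\0&-1\end{pmatrix},\qquad \tau_1=\begin{pmatrix}0&1\\1&0\end{pmatrix}.$$ $H$ is *dynamically stable* if every $g(k)$ is diagonalizable with real spectrum. The quasiparticle energy $\omega(k)$ is the eigenvalue of $g(k)$ that has an eigenvector $v$ with $v^\dagger\tau_3v=1$, and the *Krein gap* is $\Delta_{\rm Krein}=\inf_{k\in[-\pi,\pi]^D}|\omega(k)+\omega(-k)|$. A *Bogoliubov transformation diagonalizing $H$* is a family $L(k)$ with $\overline{L(k)}=\tau_1L(-k)\tau_1$, $L(k)^\dagger\tau_3L(k)=\tau_3$, $g(k)L(k)=L(k)\,\mathrm{diag}(\omega(k),-\omega(-k))$. Its *quasiparticle vacuum* is the zero-mean Gaussian state with quadrature covariance matrix $$\Gamma_{j,j'}=\frac1{(2\pi)^D}\int_{[-\pi,\pi]^D}e^{ik\cdot(j-j')}\,U^\dagger L(k)L(k)^\dagger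 U\,dk,\qquad U=\tfrac1{\sqrt2}\begin{pmatrix}1&i\\1&-i\end{pmatrix}.$$ For finite $B\subset\mathbb Z^D$ its *entanglement entropy* is the von Neumann entropy of the reduced Gaussian state, $S_B=\sum_i\big[\tfrac{\nu_i+1}2\log\tfrac{\nu_i+1}2-\tfrac{\nu_i-1}2\log\tfrac{\nu_i-1}2\big]$, where the $\nu_i$ are the symplectic eigenvalues of the restriction of $\Gamma$ to $B$. Let $s(B)$ be the number of nearest-neighbour pairs $(i,j)$ with $i\in B$, $j\notin B$, and $\mathrm{Li}_s(z)=\sum_{n\ge1}z^n/n^s$. For $c>0$, call $\xi>0$ a *correlation length (with constant $c$)* if $|\Gamma_{x_jx_{j'}}|\le c\frac{\|H_{pp}\|}{\Delta_{\rm Krein}}e^{-|j-j'|/\xi}$ and $|\Gamma_{p_jp_{j'}}|\le c\frac{\|H_{xx}\|}{\Delta_{\rm Krein}}e^{-|j-j'|/\xi}$ for all $j,j'$. **Claim.** For every $D\ge1$ there is $c>0$, depending only on $D$, such that for all $R\ge1$ and all $H$ as above that are dynamically stable with $\Delta_{\rm Krein}>0$ and $H_{xp}+H_{xp}^T=0$: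 1. (Reduction to the harmonic case with $H_{pp}=1$.) $X(k)$ and $P(k)$ do not vanish and $X(k)/P(k)>0$ for all $k$; a Bogoliubov transformation diagonalizing $H$ exists; and for each such transformation $\Gamma=\tilde H_{xx}^{-1/2}\oplus\tilde H_{xx}^{1/2}$, where $\tilde H_{xx}=H_{xx}H_{pp}^{-1}$ has symbol $X/P$. That is, $\Gamma$ is the ground-state covariance matrix of the harmonic lattice $\tilde H_{xx}\oplus\mathbf 1$. 2. (Exponential decay.) $\xi_0=c\,R\,\sqrt{\|H_{xx}\|\,\|H_{pp}\|}\,/\,\Delta_{\rm Krein}$ is a correlation length with constant $c$. 3. (Area law.) For every correlation length $\xi$ with constant $c$, in particular for $\xi_0$, and every finite $B\subset\mathbb Z^D$, $$S_B\le16c^2\,\|H_{xx}\|\,\|H_{pp}\|\;\mathrm{Li}_{1-2D}\big(e^{-1/\xi}\big)\,\frac{s(B)}{\Delta_{\rm Krein}^2}.$$ For $H_{pp}=\mathbf 1$ this is the Cramer–Eisert bound with the many-body gap replaced by $\Delta_{\rm Krein}$. -/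

import Mathlib

open scoped Matrix ComplexConjugate

noncomputable section

namespace Krein

/-- Sites of the hypercubic lattice. -/
abbrev Site (D : ℕ) : Type := Fin D → ℤ

/-- Quasi-momenta; all momentum-space functions below are `2π`-periodic in each component. -/
abbrev Momentum (D : ℕ) : Type := Fin D → ℝ

/-- The first Brillouin zone `[-π, π]^D`. -/
def BZ (D : ℕ) : Set (Momentum D) := Set.Icc (fun _ => -Real.pi) (fun _ => Real.pi)

/-- Lattice (nearest-neighbour path) length `|r|` of a displacement. -/
def len {D : ℕ} (r : Site D) : ℕ := ∑ μ, (r μ).natAbs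

/-- The pairing `k · r`. -/
def dotK {D : ℕ} (k : Momentum D) (r : Site D) : ℝ := ∑ μ, k μ * (r μ : ℝ)

/-- A finite box that contains every displacement `r` with `|r| ≤ R`. -/
def box (D R : ℕ) : Finset (Site D) := Finset.Icc (fun _ => -(R : ℤ)) (fun _ => (R : ℤ))

/-- A translationally invariant quadratic bosonic Hamiltonian on `ℤ^D` with one boson per site and
couplings of range `R`,
`H = ∑_{j,r} K_r a_j† a_{j+r} + (1/2) (Δ_r a_j† a_{j+r}† + h.c.)`. -/
structure QBH (D R : ℕ) where
  /-- hopping amplitudes -/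
  K : Site D → ℂ
  /-- pairing amplitudes -/
  Δ : Site D → ℂ
  K_neg : ∀ r, K (-r) = conj (K r)
  Δ_neg : ∀ r, Δ (-r) = Δ r
  K_range : ∀ r, R < len r → K r = 0
  Δ_range : ∀ r, R < len r → Δ r = 0

/-- The Pauli matrix `τ₁` in Nambu space. -/
def τ₁ : Matrix (Fin 2) (Fin 2) ℂ := !![0, 1; 1, 0]

/-- The Pauli matrix `τ₃` in Nambu space. -/
def τ₃ : Matrix (Fin 2) (Fin 2) ℂ := !![1, 0; 0, -1]

/-- The change of basis from quadratures to bosonic modes, `(a, a†)ᵀ = U (x, p)ᵀ`. -/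
def quadU : Matrix (Fin 2) (Fin 2) ℂ :=
  ((Real.sqrt 2 : ℝ) : ℂ)⁻¹ • !![1, Complex.I; 1, -Complex.I]

namespace QBH

variable {D R : ℕ} (H : QBH D R)

/-- `K(k) = ∑_r e^{i k·r} K_r`. -/
def Khat (k : Momentum D) : ℂ := ∑ r ∈ box D R, Complex.exp (Complex.I * dotK k r) * H.K r

/-- `Δ(k) = ∑_r e^{i k·r} Δ_r`. -/
def Δhat (k : Momentum D) : ℂ := ∑ r ∈ box D R, Complex.exp (Complex.I * dotK k r) * H.Δ r

/-- The Bloch dynamical matrix: `[H, φ(k)] = - g(k) φ(k)`. -/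
def g (k : Momentum D) : Matrix (Fin 2) (Fin 2) ℂ :=
  !![H.Khat k, H.Δhat k; -conj (H.Δhat (-k)), -conj (H.Khat (-k))]

/-- Dynamical stability: every `g(k)` is diagonalizable with real eigenvalues. -/
def DynamicallyStable : Prop :=
  ∀ k, ∃ (S : Matrix (Fin 2) (Fin 2) ℂ) (e : Fin 2 → ℝ),
    IsUnit S.det ∧ H.g k * S = S * Matrix.diagonal (fun n => (e n : ℂ))

/-- `ω` is a quasiparticle energy at momentum `k`: an eigenvalue of `g(k)` with an eigenvector
of Krein signature `+1`, normalized as `v† τ₃ v = 1`. -/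
def IsQuasiparticleEnergy (k : Momentum D) (ω : ℝ) : Prop :=
  ∃ v : Fin 2 → ℂ, H.g k *ᵥ v = (ω : ℂ) • v ∧ star v ⬝ᵥ (τ₃ *ᵥ v) = 1

/-- The (direct) Krein gap `min_k |ω(k) + ω(-k)|`. -/
def kreinGap : ℝ :=
  sInf {x : ℝ | ∃ k ∈ BZ D, ∃ ω ω' : ℝ, H.IsQuasiparticleEnergy k ω ∧
    H.IsQuasiparticleEnergy (-k) ω' ∧ x = |ω + ω'|}

/-- Position-position couplings in the quadrature form
`H = (1/2) ∑ (x H_xx x + x H_xp p + p H_xpᵀ x + p H_pp p) + const`. -/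
def Hxx : Matrix (Site D) (Site D) ℝ := Matrix.of fun j j' => (H.K (j' - j) + H.Δ (j' - j)).re

/-- Momentum-momentum couplings. -/
def Hpp : Matrix (Site D) (Site D) ℝ := Matrix.of fun j j' => (H.K (j' - j) - H.Δ (j' - j)).re

/-- Position-momentum couplings. -/
def Hxp : Matrix (Site D) (Site D) ℝ := Matrix.of fun j j' => (H.Δ (j' - j) - H.K (j' - j)).im

/-- The symbol `∑_r M_{0,r} e^{i k·r}` of a real symmetric translationally invariant matrix of
range `R`. -/
def symbol (R : ℕ) (M : Matrix (Site D) (Site D) ℝ) (k : Momentum D) : ℝ :=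
  ∑ r ∈ box D R, M 0 r * Real.cos (dotK k r)

/-- The operator norm on `ℓ²(ℤ^D)` of such a matrix; as the matrix acts in momentum space as
multiplication by its symbol, this is the supremum of the modulus of the symbol. -/
def opNorm (R : ℕ) (M : Matrix (Site D) (Site D) ℝ) : ℝ := ⨆ k, |symbol R M k|

/-- The symbol of `H_xx`. -/
def X (k : Momentum D) : ℝ := symbol R H.Hxx k

/-- The symbol of `H_pp`. -/
def P (k : Momentum D) : ℝ := symbol R H.Hpp k

/-- `‖H_xx‖`. -/
def normHxx : ℝ := opNorm R H.Hxx

/-- `‖H_pp‖`. -/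
def normHpp : ℝ := opNorm R H.Hpp

/-- A Bogoliubov transformation diagonalizing `H`: the columns of `L(k)` are the eigenvectors of
`g(k)` with energies `ω(k)` and `-ω(-k)`, and the quasiparticle modes
`(β(k), β(-k)†)ᵀ = L(k)⁻¹ (b(k), b(-k)†)ᵀ` obey the canonical commutation relations. Such a
transformation determines the quasiparticle vacuum, by `β(k) |0~⟩ = 0` for all `k`. -/
structure Bogoliubov where
  L : Momentum D → Matrix (Fin 2) (Fin 2) ℂ
  ω : Momentum D → ℝ
  conj_L : ∀ k, (L k).map (starRingEnd ℂ) = τ₁ * L (-k) * τ₁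
  pseudoUnitary : ∀ k, (L k)ᴴ * τ₃ * L k = τ₃
  diagonalizes : ∀ k, H.g k * L k = L k * Matrix.diagonal ![(ω k : ℂ), -(ω (-k) : ℂ)]

end QBH

/-- The real-space block `(2π)^{-D} ∫_BZ e^{i k·(j-j')} f(k) dk` of a covariance matrix (the real
part is the value itself, since correlations of quadratures are real). -/
def fourierBlock {D : ℕ} (f : Momentum D → ℂ) : Matrix (Site D) (Site D) ℝ :=
  Matrix.of fun j j' => Complex.re ((((2 * Real.pi : ℝ) : ℂ) ^ D)⁻¹ *
    ∫ k in BZ D, Complex.exp (Complex.I * dotK k (j - j')) * f k)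

/-- Real-space covariance matrix, in the order `(x, p)`, of a translationally invariant state
with momentum-space covariance matrix `G(k)`. -/
def realSpaceCov {D : ℕ} (G : Momentum D → Matrix (Fin 2) (Fin 2) ℂ) :
    Matrix (Site D ⊕ Site D) (Site D ⊕ Site D) ℝ :=
  Matrix.fromBlocks
    (fourierBlock fun k => G k 0 0) (fourierBlock fun k => G k 0 1)
    (fourierBlock fun k => G k 1 0) (fourierBlock fun k => G k 1 1)

/-- The covariance matrix `Γ = ⟨{R_j, R_j'}⟩` of the quasiparticle vacuum, a zero-mean Gaussian
state: `C(k) = L(k) L(k)†` in the bosonic basis, hence `U† L(k) L(k)† U` for quadratures. -/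
def QBH.Bogoliubov.Γ {D R : ℕ} {H : QBH D R} (Q : H.Bogoliubov) :
    Matrix (Site D ⊕ Site D) (Site D ⊕ Site D) ℝ :=
  realSpaceCov fun k => quadUᴴ * Q.L k * (Q.L k)ᴴ * quadU

/-- The covariance matrix `V^{-1/2} ⊕ V^{1/2}` of the ground state of the harmonic lattice
`V ⊕ 1`, where `V` is the translationally invariant matrix with symbol `V(k)`. -/
def harmonicΓ {D : ℕ} (V : Momentum D → ℝ) :
    Matrix (Site D ⊕ Site D) (Site D ⊕ Site D) ℝ :=
  realSpaceCov fun k => !![((V k ^ (-(1 / 2) : ℝ) : ℝ) : ℂ), 0; 0, ((V k ^ (1 / 2 : ℝ) : ℝ) : ℂ)]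

/-- The symplectic form on the modes of a finite region. -/
def symplecticForm (m : Type*) [DecidableEq m] : Matrix (m ⊕ m) (m ⊕ m) ℝ :=
  Matrix.fromBlocks 0 1 (-1) 0

/-- Entropy of a bosonic mode with symplectic eigenvalue `ν`. -/
def modeEntropy (ν : ℝ) : ℝ :=
  (ν + 1) / 2 * Real.log ((ν + 1) / 2) - (ν - 1) / 2 * Real.log ((ν - 1) / 2)

/-- Symplectic eigenvalues of a covariance matrix of finitely many modes: the positive eigenvalues
of `i Σ Γ`, with multiplicity. -/
def symplecticEigenvalues {m : Type*} [Fintype m] [DecidableEq m]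
    (Γ : Matrix (m ⊕ m) (m ⊕ m) ℝ) : Multiset ℝ :=
  ((Complex.I • (symplecticForm m * Γ).map Complex.ofReal).charpoly.roots.map
    Complex.re).filter fun ν => 0 < ν

/-- Covariance matrix of the reduced state of a region `B`. -/
def restrict {D : ℕ} (Γ : Matrix (Site D ⊕ Site D) (Site D ⊕ Site D) ℝ) (B : Finset (Site D)) :
    Matrix (B ⊕ B) (B ⊕ B) ℝ :=
  Γ.submatrix (Sum.map Subtype.val Subtype.val) (Sum.map Subtype.val Subtype.val)

/-- The entanglement entropy of the finite region `B` (with its complement) in the pure Gaussian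
state with covariance matrix `Γ`: the von Neumann entropy `∑ S(ν_i)` of the reduced state. -/
def entanglementEntropy {D : ℕ} (Γ : Matrix (Site D ⊕ Site D) (Site D ⊕ Site D) ℝ)
    (B : Finset (Site D)) : ℝ :=
  ((symplecticEigenvalues (restrict Γ B)).map modeEntropy).sum

/-- The boundary area `s(B)`: the number of nearest-neighbour pairs that `B` and its complement
share. -/
def area {D : ℕ} (B : Finset (Site D)) : ℕ :=
  {q : Site D × Site D | q.1 ∈ B ∧ q.2 ∉ B ∧ len (q.1 - q.2) = 1}.ncard

/-- The polylogarithm `Li_s(z) = ∑_{n ≥ 1} z^n / n^s`, of integer order, for `|z| < 1`. -/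
def polylog (s : ℤ) (z : ℝ) : ℝ := ∑' n : ℕ, z ^ (n + 1) / ((n : ℝ) + 1) ^ s

/-- `ξ` is a correlation length of the quasiparticle vacuum: position and momentum correlations
are bounded by `K_x e^{-|j-j'|/ξ}` and `K_p e^{-|j-j'|/ξ}`, with the prefactors
`K_x = c ‖H_pp‖ / Δ_Krein` and `K_p = c ‖H_xx‖ / Δ_Krein`. -/
def IsCorrelationLength {D R : ℕ} {H : QBH D R} (Q : H.Bogoliubov) (c ξ : ℝ) : Prop :=
  0 < ξ ∧ ∀ j j' : Site D,
    |Q.Γ (Sum.inl j) (Sum.inl j')| ≤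
        c * H.normHpp / H.kreinGap * Real.exp (-(len (j - j') : ℝ) / ξ) ∧
    |Q.Γ (Sum.inr j) (Sum.inr j')| ≤
        c * H.normHxx / H.kreinGap * Real.exp (-(len (j - j') : ℝ) / ξ)

end Krein

end

/-!
Since `H_xp` is antisymmetric, `Δ(k)` is real, and in quadratures `g(k)` is `η(k)` times the
identity, with `η` odd, plus the off-diagonal matrix with entries `i P(k)` and `-i X(k)`. Its
eigenvalues are `η ± √(X P)`; the odd drift `η` cancels in `ω(k) + ω(-k)`, so the Krein gap bounds
`4 X P` from below by its square, and the vacuum covariances have the symbols `√(P / X)` and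
`√(X / P)`.

Up to sign these are `P` or `X` times `(X P)^{-1/2}`. On the range of `X P` the inverse square root
is approximated by truncating the generating function of the Legendre polynomials, with an error
exponentially small in the degree. A polynomial in `X P` has finite range, so the Fourier
coefficients decay exponentially.

For a region `B` with position and momentum blocks `A` and `C` of the covariance, the squared
symplectic eigenvalues are `1 + t` with `t` the eigenvalues of `(C - A⁻¹) A`, and a mode contributes
at most `(3 / 2) √t` to the entropy. The Schur complement and Peierls' inequality bound `∑ √t` by
the correlations between `B` and its complement. A displacement `r` leaves `B` from at most
`|r| s(B)` sites, and summing over the displacements gives the polylogarithm.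
-/

noncomputable section

namespace Krein

/-! ### Polynomial approximation of the inverse square root -/

section InverseSquareRoot

open Polynomial Finset.HasAntidiagonal

lemma multichoose_add {R : Type*} [CommRing R] [BinomialRing R] (r s : R) (n : ℕ) :
    Ring.multichoose (r + s) n =
      ∑ p ∈ antidiagonal n, Ring.multichoose r p.1 * Ring.multichoose s p.2 := by
  have multichoose_eq_choose_neg (t : R) (k : ℕ) :
      Ring.multichoose t k = (-1) ^ k * Ring.choose (-t) k := by
    rw [Ring.choose_neg, ← Ring.multichoose_eq, Int.negOnePow_def, zpow_natCast, Units.smul_def,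
      zsmul_eq_mul, ← mul_assoc]
    simp [← mul_pow]
  rw [multichoose_eq_choose_neg, neg_add, Ring.add_choose_eq n (Commute.all _ _), Finset.mul_sum]
  refine Finset.sum_congr rfl fun p hp => ?_
  rw [multichoose_eq_choose_neg r, multichoose_eq_choose_neg s, ← mem_antidiagonal.mp hp,
    pow_add]
  ring

lemma multichoose_pos {r : ℝ} (hr : 0 < r) (n : ℕ) : 0 < Ring.multichoose r n := by
  have h := ascPochhammer_pos n r hr
  rw [← ascPochhammer_smeval_eq_eval, ← Ring.factorial_nsmul_multichoose_eq_ascPochhammer,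
    nsmul_eq_mul] at h
  exact pos_of_mul_pos_right h (Nat.cast_nonneg _)

/-- The Taylor coefficients of `(1 - z)^{-1/2}`. -/
def invSqrtCoeff (n : ℕ) : ℝ := Ring.multichoose (1 / 2) n

lemma invSqrtCoeff_nonneg (n : ℕ) : 0 ≤ invSqrtCoeff n :=
  (multichoose_pos one_half_pos n).le

lemma sum_antidiagonal_invSqrtCoeff (n : ℕ) :
    ∑ p ∈ antidiagonal n, invSqrtCoeff p.1 * invSqrtCoeff p.2 = 1 := by
  simp only [invSqrtCoeff]
  rw [← multichoose_add, add_halves, Ring.multichoose_one]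

lemma invSqrtCoeff_le_one (n : ℕ) : invSqrtCoeff n ≤ 1 := by
  have h := Finset.single_le_sum
    (f := fun p : ℕ × ℕ => invSqrtCoeff p.1 * invSqrtCoeff p.2)
    (fun p _ => mul_nonneg (invSqrtCoeff_nonneg _) (invSqrtCoeff_nonneg _))
    ((mem_antidiagonal (a := (0, n))).mpr (zero_add n))
  rwa [sum_antidiagonal_invSqrtCoeff, show invSqrtCoeff 0 = 1 by simp [invSqrtCoeff],
    one_mul] at h

lemma summable_norm_invSqrtCoeff_mul_pow {z : ℂ} (hz : ‖z‖ < 1) :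
    Summable fun n => ‖(invSqrtCoeff n : ℂ) * z ^ n‖ := by
  refine (summable_geometric_of_lt_one (norm_nonneg z) hz).of_nonneg_of_le
    (fun _ => norm_nonneg _) fun n => ?_
  rw [norm_mul, norm_pow, Complex.norm_of_nonneg (invSqrtCoeff_nonneg n)]
  exact mul_le_of_le_one_left (by positivity) (invSqrtCoeff_le_one n)

lemma sq_tsum_invSqrtCoeff_mul_pow {z : ℂ} (hz : ‖z‖ < 1) :
    (∑' n, (invSqrtCoeff n : ℂ) * z ^ n) ^ 2 = (1 - z)⁻¹ := by
  have hs := summable_norm_invSqrtCoeff_mul_pow hz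
  rw [sq, tsum_mul_tsum_eq_tsum_sum_antidiagonal_of_summable_norm hs hs,
    ← tsum_geometric_of_norm_lt_one hz]
  refine tsum_congr fun n => ?_
  have h : ∑ p ∈ antidiagonal n, (invSqrtCoeff p.1 * invSqrtCoeff p.2 : ℂ) = 1 :=
    mod_cast sum_antidiagonal_invSqrtCoeff n
  rw [← one_mul (z ^ n), ← h, Finset.sum_mul]
  refine Finset.sum_congr rfl fun p hp => ?_
  rw [← mem_antidiagonal.mp hp, pow_add]
  ring

lemma normSq_tsum_invSqrtCoeff_mul_pow {z : ℂ} (hz : ‖z‖ < 1) :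
    Complex.normSq (∑' n, (invSqrtCoeff n : ℂ) * z ^ n) = 1 / ‖1 - z‖ := by
  rw [Complex.normSq_eq_norm_sq, ← norm_pow, sq_tsum_invSqrtCoeff_mul_pow hz, norm_inv, one_div]

/-- The `n`-th Legendre polynomial, in its Chebyshev expansion: factorizing
`1 + ρ² - 2 ρ cos θ = (1 - ρ e^{iθ}) (1 - ρ e^{-iθ})`, the generating function is the product of
two binomial series. -/
def legendre (n : ℕ) : ℝ[X] :=
  ∑ p ∈ antidiagonal n,
    C (invSqrtCoeff p.1 * invSqrtCoeff p.2) * Chebyshev.T ℝ (p.1 - p.2 : ℤ)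

lemma natDegree_legendre_le (n : ℕ) : (legendre n).natDegree ≤ n := by
  refine natDegree_sum_le_of_forall_le _ _ fun p hp => (natDegree_C_mul_le _ _).trans ?_
  have := mem_antidiagonal.mp hp
  rw [Chebyshev.natDegree_T]
  omega

lemma abs_eval_legendre_le_one (n : ℕ) {t : ℝ} (ht : |t| ≤ 1) : |(legendre n).eval t| ≤ 1 := by
  rw [legendre, eval_finsetSum, ← sum_antidiagonal_invSqrtCoeff n]
  refine (Finset.abs_sum_le_sum_abs _ _).trans (Finset.sum_le_sum fun p _ => ?_)
  have h := mul_nonneg (invSqrtCoeff_nonneg p.1) (invSqrtCoeff_nonneg p.2)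
  rw [eval_mul, eval_C, abs_mul, abs_of_nonneg h]
  exact mul_le_of_le_one_right h (Chebyshev.abs_eval_T_real_le_one _ ht)

lemma re_sum_antidiagonal_invSqrtCoeff (ρ θ : ℝ) (n : ℕ) :
    (∑ p ∈ antidiagonal n,
      (invSqrtCoeff p.1 : ℂ) * (ρ * Complex.exp (θ * Complex.I)) ^ p.1 *
        (invSqrtCoeff p.2 * conj (ρ * Complex.exp (θ * Complex.I)) ^ p.2)).re =
      ρ ^ n * (legendre n).eval (Real.cos θ) := by
  rw [legendre, eval_finsetSum, Complex.re_sum, Finset.mul_sum]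
  refine Finset.sum_congr rfl fun p hp => ?_
  have hexp : Complex.exp (θ * Complex.I) ^ p.1 * conj (Complex.exp (θ * Complex.I)) ^ p.2 =
      Complex.exp (((((p.1 - p.2 : ℤ) : ℝ) * θ : ℝ) : ℂ) * Complex.I) := by
    rw [← Complex.exp_conj, ← Complex.exp_nat_mul, ← Complex.exp_nat_mul, ← Complex.exp_add]
    congr 1
    simp only [map_mul, Complex.conj_ofReal, Complex.conj_I]
    push_cast
    ring
  have hterm : (invSqrtCoeff p.1 : ℂ) * (ρ * Complex.exp (θ * Complex.I)) ^ p.1 *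
      (invSqrtCoeff p.2 * conj (ρ * Complex.exp (θ * Complex.I)) ^ p.2) =
      ((ρ ^ n * (invSqrtCoeff p.1 * invSqrtCoeff p.2) : ℝ) : ℂ) *
        Complex.exp (((((p.1 - p.2 : ℤ) : ℝ) * θ : ℝ) : ℂ) * Complex.I) := by
    rw [← hexp, ← mem_antidiagonal.mp hp, map_mul, Complex.conj_ofReal]
    push_cast
    ring
  rw [hterm, Complex.re_ofReal_mul, Complex.exp_ofReal_mul_I_re, eval_mul, eval_C,
    Chebyshev.T_real_cos, mul_assoc]

lemma hasSum_legendre {ρ t : ℝ} (hρ : |ρ| < 1) (ht : |t| ≤ 1) :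
    HasSum (fun n => ρ ^ n * (legendre n).eval t) (1 / √(1 + ρ ^ 2 - 2 * ρ * t)) := by
  obtain ⟨θ, rfl⟩ : ∃ θ, Real.cos θ = t :=
    ⟨_, Real.cos_arccos (abs_le.mp ht).1 (abs_le.mp ht).2⟩
  set z : ℂ := ρ * Complex.exp (θ * Complex.I) with hz
  have hz1 : ‖z‖ < 1 := by simpa [hz, Complex.norm_exp_ofReal_mul_I] using hρ
  have hs := summable_norm_invSqrtCoeff_mul_pow hz1
  have hs' := summable_norm_invSqrtCoeff_mul_pow ((RCLike.norm_conj z).trans_lt hz1)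
  have hconj : ∑' n, (invSqrtCoeff n : ℂ) * conj z ^ n =
      conj (∑' n, (invSqrtCoeff n : ℂ) * z ^ n) := by
    rw [Complex.conj_tsum]
    simp
  have hnorm : ‖1 - z‖ = √(1 + ρ ^ 2 - 2 * ρ * Real.cos θ) := by
    have hre : z.re = ρ * Real.cos θ := by
      rw [hz, Complex.re_ofReal_mul, Complex.exp_ofReal_mul_I_re]
    have him : z.im = ρ * Real.sin θ := by
      rw [hz, Complex.im_ofReal_mul, Complex.exp_ofReal_mul_I_im]
    rw [Complex.norm_def, Complex.normSq_apply, Complex.sub_re, Complex.sub_im, hre, him,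
      Complex.one_re, Complex.one_im]
    congr 1
    linear_combination ρ ^ 2 * Real.sin_sq_add_cos_sq θ
  have hsum := (summable_norm_sum_mul_antidiagonal_of_summable_norm hs hs').of_norm.hasSum
  rw [← tsum_mul_tsum_eq_tsum_sum_antidiagonal_of_summable_norm hs hs', hconj, Complex.mul_conj,
    normSq_tsum_invSqrtCoeff_mul_pow hz1, hnorm] at hsum
  simpa only [hz, re_sum_antidiagonal_invSqrtCoeff, Complex.ofReal_re] using
    Complex.hasSum_re hsum

lemma abs_inv_sqrt_sub_sum_legendre_le {ρ t : ℝ} (hρ0 : 0 ≤ ρ) (hρ1 : ρ < 1) (ht : |t| ≤ 1)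
    (n : ℕ) :
    |1 / √(1 + ρ ^ 2 - 2 * ρ * t) - ∑ j ∈ Finset.range n, ρ ^ j * (legendre j).eval t| ≤
      ρ ^ n / (1 - ρ) := by
  have hbound (j : ℕ) : ‖ρ ^ j * (legendre j).eval t‖ ≤ 1 * ρ ^ j := by
    rw [norm_mul, norm_pow, Real.norm_of_nonneg hρ0, mul_comm]
    exact mul_le_mul_of_nonneg_right (abs_eval_legendre_le_one j ht) (by positivity)
  rw [abs_sub_comm, ← one_mul (ρ ^ n)]
  exact norm_sub_le_of_geometric_bound_of_hasSum hρ1 hbound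
    (hasSum_legendre (by rwa [abs_of_nonneg hρ0]) ht) n

lemma exists_polynomial_approx_inv_sqrt_Icc_sq {a ρ : ℝ} (ha : 0 < a) (hρ0 : 0 < ρ) (hρ1 : ρ < 1)
    (n : ℕ) :
    ∃ q ∈ degreeLT ℝ n, ∀ x ∈ Set.Icc ((a * (1 - ρ)) ^ 2) ((a * (1 + ρ)) ^ 2),
      |1 / √x - q.eval x| ≤ ρ ^ n / (a * (1 - ρ)) := by
  -- The inverse of `t ↦ a² (1 + ρ² - 2 ρ t)`, which sends `[-1, 1]` onto the interval.
  let ℓ : ℝ[X] := C ((1 + ρ ^ 2) / (2 * ρ)) - C (1 / (2 * ρ * a ^ 2)) * X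
  have hℓ : ℓ.natDegree ≤ 1 := by simp only [ℓ]; compute_degree
  refine ⟨C (1 / a) * ∑ j ∈ Finset.range n, C (ρ ^ j) * (legendre j).comp ℓ, ?_, fun x hx => ?_⟩
  · rw [C_mul']
    refine Submodule.smul_mem _ _ (Submodule.sum_mem _ fun j hj => ?_)
    rw [C_mul']
    refine Submodule.smul_mem _ _ (mem_degreeLT.mpr (degree_le_natDegree.trans_lt ?_))
    have hdeg : ((legendre j).comp ℓ).natDegree ≤ j * 1 :=
      natDegree_comp_le.trans (Nat.mul_le_mul (natDegree_legendre_le j) hℓ)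
    exact mod_cast (hdeg.trans_eq (mul_one j)).trans_lt (Finset.mem_range.mp hj)
  · have hx_eq : x = a ^ 2 * (1 + ρ ^ 2 - 2 * ρ * ℓ.eval x) := by
      simp only [ℓ, eval_sub, eval_mul, eval_C, eval_X]
      field_simp
      ring
    have ht : |ℓ.eval x| ≤ 1 := by
      obtain ⟨hlo, hhi⟩ := hx
      have hpos : 0 < a ^ 2 * (2 * ρ) := by positivity
      exact abs_le.mpr ⟨le_of_mul_le_mul_left (by linarith) hpos,
        le_of_mul_le_mul_left (by linarith) hpos⟩
    have hsqrt : 1 / √x = 1 / a * (1 / √(1 + ρ ^ 2 - 2 * ρ * ℓ.eval x)) := by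
      conv_lhs => rw [hx_eq]
      rw [Real.sqrt_mul (by positivity), Real.sqrt_sq ha.le, one_div_mul_one_div]
    simp only [eval_mul, eval_C, eval_finsetSum, eval_comp]
    rw [hsqrt, ← mul_sub, abs_mul, abs_of_pos (by positivity : 0 < 1 / a)]
    calc _ ≤ 1 / a * (ρ ^ n / (1 - ρ)) := by
          gcongr
          exact abs_inv_sqrt_sub_sum_legendre_le hρ0.le hρ1 ht n
      _ = ρ ^ n / (a * (1 - ρ)) := one_div_mul_eq_div ..|>.trans (by rw [div_div, mul_comm])

theorem exists_polynomial_approx_inv_sqrt {m M : ℝ} (hm : 0 < m) (hM : m < M) (n : ℕ) :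
    ∃ q ∈ degreeLT ℝ n, ∀ x ∈ Set.Icc m M,
      |1 / √x - q.eval x| ≤ ((√M - √m) / (√M + √m)) ^ n / √m := by
  have hm0 : 0 < √m := Real.sqrt_pos.mpr hm
  have hmM : √m < √M := Real.sqrt_lt_sqrt hm.le hM
  set ρ := (√M - √m) / (√M + √m) with hρ
  have hρ0 : 0 < ρ := div_pos (by linarith) (by linarith)
  have hρ1 : ρ < 1 := by rw [hρ, div_lt_one (by linarith)]; linarith
  have hm_eq : (√M + √m) / 2 * (1 - ρ) = √m := by rw [hρ]; field
  have hM_eq : (√M + √m) / 2 * (1 + ρ) = √M := by rw [hρ]; field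
  have h := exists_polynomial_approx_inv_sqrt_Icc_sq (a := (√M + √m) / 2) (by linarith) hρ0 hρ1 n
  rwa [hm_eq, hM_eq, Real.sq_sqrt hm.le, Real.sq_sqrt (hm.trans hM).le] at h

end InverseSquareRoot

/-! ### Lattice lengths, Brillouin-zone averages and Fourier coefficients -/

section Lattice

open MeasureTheory

variable {D : ℕ}

@[simp] lemma len_neg (r : Site D) : len (-r) = len r := by simp [len]

@[simp] lemma len_zero : len (0 : Site D) = 0 := by simp [len]

lemma len_add_le (r s : Site D) : len (r + s) ≤ len r + len s := by
  unfold len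
  rw [← Finset.sum_add_distrib]
  exact Finset.sum_le_sum fun μ _ => Int.natAbs_add_le _ _

lemma len_sub_le (r s : Site D) : len (r - s) ≤ len r + len s := by
  rw [sub_eq_add_neg, ← len_neg s]
  exact len_add_le _ _

lemma len_sub_comm (r s : Site D) : len (r - s) = len (s - r) := by
  rw [← len_neg, neg_sub]

lemma natAbs_le_len (r : Site D) (μ : Fin D) : (r μ).natAbs ≤ len r :=
  Finset.single_le_sum (f := fun μ => (r μ).natAbs) (fun _ _ => Nat.zero_le _) (Finset.mem_univ μ)

lemma len_eq_zero {r : Site D} : len r = 0 ↔ r = 0 := by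
  simp [len, funext_iff]

lemma mem_box {r : Site D} {N : ℕ} : r ∈ box D N ↔ ∀ μ, (r μ).natAbs ≤ N := by
  simp only [box, Finset.mem_Icc, Pi.le_def, ← forall_and]
  exact forall_congr' fun μ => by omega

lemma mem_box_of_len_le {r : Site D} {N : ℕ} (h : len r ≤ N) : r ∈ box D N :=
  mem_box.mpr fun μ => (natAbs_le_len r μ).trans h

lemma neg_mem_box {r : Site D} {N : ℕ} : -r ∈ box D N ↔ r ∈ box D N := by
  simp [mem_box]

/-- The sites of path length at most `N`. -/
def lenBall (D N : ℕ) : Finset (Site D) := (box D N).filter fun r => len r ≤ N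

@[simp] lemma mem_lenBall {N : ℕ} {r : Site D} : r ∈ lenBall D N ↔ len r ≤ N := by
  simp only [lenBall, Finset.mem_filter, and_iff_right_iff_imp]
  exact mem_box_of_len_le

lemma dotK_add (k : Momentum D) (r s : Site D) : dotK k (r + s) = dotK k r + dotK k s := by
  simp [dotK, mul_add, Finset.sum_add_distrib]

@[simp] lemma dotK_neg (k : Momentum D) (r : Site D) : dotK k (-r) = -dotK k r := by
  simp [dotK]

lemma dotK_sub (k : Momentum D) (r s : Site D) : dotK k (r - s) = dotK k r - dotK k s := by
  rw [sub_eq_add_neg, dotK_add, dotK_neg, sub_eq_add_neg]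

@[simp] lemma neg_dotK (k : Momentum D) (r : Site D) : dotK (-k) r = -dotK k r := by
  simp [dotK]

@[simp] lemma dotK_zero (k : Momentum D) : dotK k 0 = 0 := by simp [dotK]

@[fun_prop] lemma continuous_dotK (r : Site D) : Continuous fun k => dotK k r := by
  unfold dotK; fun_prop

lemma volume_BZ : volume (BZ D) = ENNReal.ofReal ((2 * Real.pi) ^ D) := by
  rw [BZ, Real.volume_Icc_pi, Finset.prod_const, Finset.card_univ, Fintype.card_fin,
    ← ENNReal.ofReal_pow (by linarith [Real.pi_pos])]
  ring_nf

lemma isCompact_BZ : IsCompact (BZ D) := isCompact_Icc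

variable (D) in
/-- The normalized Lebesgue measure on the Brillouin zone. -/
def bzMeasure : Measure (Momentum D) := ProbabilityTheory.cond volume (BZ D)

instance : IsProbabilityMeasure (bzMeasure D) :=
  ProbabilityTheory.cond_isProbabilityMeasure_of_finite
    (by rw [volume_BZ]; simp [Real.pi_pos]) isCompact_BZ.measure_ne_top

lemma integral_bzMeasure {E : Type*} [NormedAddCommGroup E] [NormedSpace ℝ E]
    (f : Momentum D → E) :
    ∫ k, f k ∂bzMeasure D = ((2 * Real.pi) ^ D)⁻¹ • ∫ k in BZ D, f k := by
  rw [bzMeasure, ProbabilityTheory.cond, integral_smul_measure, volume_BZ, ENNReal.toReal_inv,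
    ENNReal.toReal_ofReal (by positivity)]

lemma integrable_bzMeasure {E : Type*} [NormedAddCommGroup E] {f : Momentum D → E}
    (hf : Continuous f) : Integrable f (bzMeasure D) :=
  (hf.continuousOn.integrableOn_compact isCompact_BZ).smul_measure
    (ENNReal.inv_ne_top.mpr (by rw [volume_BZ]; simp [Real.pi_pos]))

lemma exp_I_mul_dotK (k : Momentum D) (r : Site D) :
    Complex.exp (Complex.I * dotK k r) = ∏ μ, Complex.exp (Complex.I * r μ * k μ) := by
  rw [← Complex.exp_sum, dotK]
  push_cast
  rw [Finset.mul_sum]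
  exact congrArg Complex.exp (Finset.sum_congr rfl fun μ _ => by ring)

lemma re_exp_I_mul (x : ℝ) : (Complex.exp (Complex.I * x)).re = Real.cos x := by
  rw [mul_comm, Complex.exp_ofReal_mul_I_re]

lemma integral_exp_I_mul_intCast_eq_zero {n : ℤ} (hn : n ≠ 0) :
    ∫ x : ℝ in Set.Icc (-Real.pi) Real.pi, Complex.exp (Complex.I * n * x) = 0 := by
  have hexp : Complex.exp (Complex.I * n * (Real.pi : ℝ)) =
      Complex.exp (Complex.I * n * (-Real.pi : ℝ)) := by
    rw [Complex.exp_eq_exp_iff_exists_int]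
    exact ⟨n, by push_cast; ring⟩
  rw [integral_Icc_eq_integral_Ioc,
    ← intervalIntegral.integral_of_le (by linarith [Real.pi_pos]),
    integral_exp_mul_complex (mul_ne_zero Complex.I_ne_zero (Int.cast_ne_zero.mpr hn)), hexp,
    sub_self, zero_div]

lemma integral_exp_dotK_eq_zero {r : Site D} (hr : r ≠ 0) :
    ∫ k, Complex.exp (Complex.I * dotK k r) ∂bzMeasure D = 0 := by
  obtain ⟨μ, hμ⟩ := Function.ne_iff.mp hr
  simp_rw [integral_bzMeasure, exp_I_mul_dotK]
  rw [BZ, ← Set.pi_univ_Icc, volume_pi, Measure.restrict_pi_pi,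
    integral_fintype_prod_eq_prod
      (f := fun μ (x : ℝ) => Complex.exp (Complex.I * (r μ : ℂ) * (x : ℂ))),
    Finset.prod_eq_zero (Finset.mem_univ μ) (integral_exp_I_mul_intCast_eq_zero hμ), smul_zero]

lemma integral_cos_dotK (r : Site D) :
    ∫ k, Real.cos (dotK k r) ∂bzMeasure D = if r = 0 then 1 else 0 := by
  split_ifs with h
  · simp [h]
  · simp_rw [← re_exp_I_mul]
    have hre := integral_re (𝕜 := ℂ) (integrable_bzMeasure (D := D)
      (f := fun k => Complex.exp (Complex.I * dotK k r)) (by fun_prop))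
    rw [integral_exp_dotK_eq_zero h] at hre
    simpa using hre

/-- The cosine Fourier coefficients of a function on the Brillouin zone; for an even function
these are its Fourier coefficients. -/
def coeff (f : Momentum D → ℝ) (r : Site D) : ℝ := ∫ k, Real.cos (dotK k r) * f k ∂bzMeasure D

@[simp] lemma coeff_neg_site (f : Momentum D → ℝ) (r : Site D) : coeff f (-r) = coeff f r := by
  simp [coeff]

lemma coeff_sub_comm (f : Momentum D → ℝ) (r s : Site D) :
    coeff f (r - s) = coeff f (s - r) := by
  rw [← coeff_neg_site, neg_sub]

lemma coeff_sub {f g : Momentum D → ℝ} (hf : Continuous f) (hg : Continuous g) (r : Site D) :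
    coeff (fun k => f k - g k) r = coeff f r - coeff g r := by
  simp only [coeff, mul_sub]
  exact integral_sub (integrable_bzMeasure (by fun_prop)) (integrable_bzMeasure (by fun_prop))

lemma abs_coeff_le {f : Momentum D → ℝ} {c : ℝ} (h : ∀ k, |f k| ≤ c) (r : Site D) :
    |coeff f r| ≤ c := by
  have hbound (k : Momentum D) : ‖Real.cos (dotK k r) * f k‖ ≤ c := by
    rw [norm_mul]
    exact (mul_le_of_le_one_left (norm_nonneg _) (Real.abs_cos_le_one _)).trans (h k)
  simpa [coeff] using norm_integral_le_of_norm_le_const (μ := bzMeasure D) (.of_forall hbound)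

lemma fourierBlock_ofReal {f : Momentum D → ℝ} (hf : Continuous f) (j j' : Site D) :
    fourierBlock (fun k => (f k : ℂ)) j j' = coeff f (j - j') := by
  have hre := integral_re (𝕜 := ℂ) (integrable_bzMeasure (D := D)
    (f := fun k => Complex.exp (Complex.I * dotK k (j - j')) * f k) (by fun_prop))
  simp only [RCLike.re_to_complex, Complex.re_mul_ofReal, re_exp_I_mul, integral_bzMeasure,
    Complex.real_smul] at hre
  rw [fourierBlock, Matrix.of_apply, coeff, integral_bzMeasure, hre]
  push_cast
  rfl

end Lattice

/-! ### Trigonometric polynomials -/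

section TrigonometricPolynomials

open MeasureTheory

variable {D : ℕ}

/-- Even real trigonometric polynomials of degree at most `N`, the degree of `cos (k · r)` being
the path length of `r`. -/
def trigPoly (D N : ℕ) : Submodule ℝ (Momentum D → ℝ) :=
  Submodule.span ℝ {f | ∃ r : Site D, len r ≤ N ∧ f = fun k => Real.cos (dotK k r)}

lemma cos_mem_trigPoly {r : Site D} {N : ℕ} (h : len r ≤ N) :
    (fun k => Real.cos (dotK k r)) ∈ trigPoly D N :=
  Submodule.subset_span ⟨r, h, rfl⟩

lemma trigPoly_mono {M N : ℕ} (h : M ≤ N) : trigPoly D M ≤ trigPoly D N :=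
  Submodule.span_mono fun _ ⟨r, hr, hf⟩ => ⟨r, hr.trans h, hf⟩

lemma one_mem_trigPoly (N : ℕ) : (1 : Momentum D → ℝ) ∈ trigPoly D N := by
  convert cos_mem_trigPoly (D := D) (r := 0) (N := N) (by simp)
  simp

lemma continuous_of_mem_trigPoly {N : ℕ} {f : Momentum D → ℝ} (hf : f ∈ trigPoly D N) :
    Continuous f := by
  induction hf using Submodule.span_induction with
  | mem f h => obtain ⟨r, -, rfl⟩ := h; fun_prop
  | zero => exact continuous_const
  | add f g _ _ hf hg => exact hf.add hg
  | smul c f _ hf => exact continuous_const.mul hf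

lemma cos_mul_cos_mem_trigPoly {M N : ℕ} {r s : Site D} (hr : len r ≤ M) (hs : len s ≤ N) :
    ((fun k => Real.cos (dotK k r)) * fun k => Real.cos (dotK k s)) ∈ trigPoly D (M + N) := by
  have hprod : ((fun k : Momentum D => Real.cos (dotK k r)) * fun k => Real.cos (dotK k s)) =
      (1 / 2 : ℝ) • ((fun k => Real.cos (dotK k (r + s))) +
        fun k => Real.cos (dotK k (r - s))) := by
    funext k
    simp only [Pi.mul_apply, Pi.smul_apply, Pi.add_apply, dotK_add, dotK_sub, Real.cos_add,
      Real.cos_sub, smul_eq_mul]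
    ring
  rw [hprod]
  exact Submodule.smul_mem _ _ (Submodule.add_mem _
    (cos_mem_trigPoly ((len_add_le r s).trans (add_le_add hr hs)))
    (cos_mem_trigPoly ((len_sub_le r s).trans (add_le_add hr hs))))

lemma mul_mem_trigPoly {M N : ℕ} {f g : Momentum D → ℝ} (hf : f ∈ trigPoly D M)
    (hg : g ∈ trigPoly D N) : f * g ∈ trigPoly D (M + N) := by
  have hle : trigPoly D M * trigPoly D N ≤ trigPoly D (M + N) := by
    rw [trigPoly, trigPoly, Submodule.span_mul_span, Submodule.span_le]
    rintro _ ⟨_, ⟨r, hr, rfl⟩, _, ⟨s, hs, rfl⟩, rfl⟩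
    exact cos_mul_cos_mem_trigPoly hr hs
  exact hle (Submodule.mul_mem_mul hf hg)

lemma pow_mem_trigPoly {N : ℕ} {f : Momentum D → ℝ} (hf : f ∈ trigPoly D N) (n : ℕ) :
    f ^ n ∈ trigPoly D (n * N) := by
  induction n with
  | zero => rw [pow_zero]; exact one_mem_trigPoly _
  | succ n ih => rw [pow_succ, Nat.succ_mul]; exact mul_mem_trigPoly ih hf

lemma mul_eval_mem_trigPoly {M N n : ℕ} {f g : Momentum D → ℝ} (hg : g ∈ trigPoly D M)
    (hf : f ∈ trigPoly D N) {q : Polynomial ℝ} (hq : q ∈ Polynomial.degreeLT ℝ n) :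
    (fun k => g k * q.eval (f k)) ∈ trigPoly D (M + (n - 1) * N) := by
  have hsum : (fun k => g k * q.eval (f k)) =
      ∑ i ∈ Finset.range (q.natDegree + 1), q.coeff i • (g * f ^ i) := by
    funext k
    simp only [Polynomial.eval_eq_sum_range, Finset.mul_sum, Finset.sum_apply, Pi.smul_apply,
      Pi.mul_apply, Pi.pow_apply, smul_eq_mul]
    exact Finset.sum_congr rfl fun i _ => by ring
  rw [hsum]
  refine Submodule.sum_mem _ fun i _ => ?_
  by_cases hi : q.coeff i = 0
  · rw [hi, zero_smul]
    exact Submodule.zero_mem _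
  · have hin : i < n := by
      by_contra! h
      exact hi (Polynomial.coeff_eq_zero_of_degree_lt
        ((Polynomial.mem_degreeLT.mp hq).trans_le (mod_cast h)))
    exact Submodule.smul_mem _ _ (trigPoly_mono (by gcongr; omega)
      (mul_mem_trigPoly hg (pow_mem_trigPoly hf i)))

lemma coeff_cos (r s : Site D) : coeff (fun k => Real.cos (dotK k r)) s =
    1 / 2 * ((if r = s then 1 else 0) + if r = -s then 1 else 0) := by
  have hprod (k : Momentum D) : Real.cos (dotK k s) * Real.cos (dotK k r) =
      1 / 2 * (Real.cos (dotK k (r - s)) + Real.cos (dotK k (r + s))) := by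
    rw [dotK_add, dotK_sub, Real.cos_add, Real.cos_sub]
    ring
  simp only [coeff, hprod]
  rw [integral_const_mul,
    integral_add (integrable_bzMeasure (by fun_prop)) (integrable_bzMeasure (by fun_prop)),
    integral_cos_dotK, integral_cos_dotK]
  simp only [sub_eq_zero, add_eq_zero_iff_eq_neg]

lemma integral_mul_eq_zero_of_mem_trigPoly {N : ℕ} {f g : Momentum D → ℝ} (hf : f ∈ trigPoly D N)
    (hg : Continuous g) (h : ∀ r, len r ≤ N → coeff g r = 0) :
    ∫ k, f k * g k ∂bzMeasure D = 0 := by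
  induction hf using Submodule.span_induction with
  | mem f hf => obtain ⟨r, hr, rfl⟩ := hf; exact h r hr
  | zero => simp
  | add f₁ f₂ hf₁ hf₂ h₁ h₂ =>
    have hf₁ := continuous_of_mem_trigPoly hf₁
    have hf₂ := continuous_of_mem_trigPoly hf₂
    simp only [Pi.add_apply, add_mul]
    rw [integral_add (integrable_bzMeasure (by fun_prop)) (integrable_bzMeasure (by fun_prop)),
      h₁, h₂, add_zero]
  | smul c f _ h =>
    simp only [Pi.smul_apply, smul_eq_mul, mul_assoc]
    rw [integral_const_mul, h, mul_zero]

lemma coeff_eq_zero_of_mem_trigPoly {N : ℕ} {f : Momentum D → ℝ} (hf : f ∈ trigPoly D N)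
    {s : Site D} (hs : N < len s) : coeff f s = 0 := by
  simp only [coeff, mul_comm (Real.cos _)]
  refine integral_mul_eq_zero_of_mem_trigPoly hf (by fun_prop) fun r hr => ?_
  rw [coeff_cos, if_neg, if_neg]
  · simp
  · rintro rfl
    exact hs.not_ge (by simpa using hr)
  · rintro rfl
    exact hs.not_ge hr

/-- The Fourier sum of an even function over the displacements of length at most `N`. -/
def fourierSum (N : ℕ) (f : Momentum D → ℝ) : Momentum D → ℝ :=
  ∑ r ∈ lenBall D N, coeff f r • fun k => Real.cos (dotK k r)

lemma fourierSum_mem_trigPoly (N : ℕ) (f : Momentum D → ℝ) : fourierSum N f ∈ trigPoly D N :=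
  Submodule.sum_mem _ fun _ hr => Submodule.smul_mem _ _ (cos_mem_trigPoly (mem_lenBall.mp hr))

lemma integral_fourierSum_mul {f g : Momentum D → ℝ} (hg : Continuous g) (N : ℕ) :
    ∫ k, fourierSum N f k * g k ∂bzMeasure D = ∑ r ∈ lenBall D N, coeff f r * coeff g r := by
  simp only [fourierSum, Finset.sum_apply, Pi.smul_apply, smul_eq_mul, Finset.sum_mul]
  rw [integral_finsetSum _ fun r _ => integrable_bzMeasure (by fun_prop)]
  simp only [mul_assoc, integral_const_mul, coeff]

lemma coeff_fourierSum {N : ℕ} {r : Site D} (hr : len r ≤ N) (f : Momentum D → ℝ) :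
    coeff (fourierSum N f) r = coeff f r := by
  rw [coeff]
  simp only [mul_comm (Real.cos _)]
  rw [integral_fourierSum_mul (by fun_prop)]
  simp only [coeff_cos, eq_comm (a := r), mul_add, mul_ite, mul_one, mul_zero,
    Finset.sum_add_distrib, neg_eq_iff_eq_neg, Finset.sum_ite_eq', mem_lenBall, hr, if_true,
    len_neg, coeff_neg_site]
  ring

lemma integral_sq_add_of_orthogonal {f g : Momentum D → ℝ} (hf : Continuous f)
    (hg : Continuous g) (h : ∫ k, f k * g k ∂bzMeasure D = 0) :
    ∫ k, (f k + g k) ^ 2 ∂bzMeasure D =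
      ∫ k, f k ^ 2 ∂bzMeasure D + ∫ k, g k ^ 2 ∂bzMeasure D := by
  have hexpand (k : Momentum D) : (f k + g k) ^ 2 = f k ^ 2 + 2 * (f k * g k) + g k ^ 2 := by
    ring
  simp only [hexpand]
  rw [integral_add (integrable_bzMeasure (by fun_prop)) (integrable_bzMeasure (by fun_prop)),
    integral_add (integrable_bzMeasure (by fun_prop)) (integrable_bzMeasure (by fun_prop)),
    integral_const_mul, h, mul_zero, add_zero]

lemma integral_sq_le_sum_sq_coeff_add {v : Momentum D → ℝ} (hv : Continuous v) {N : ℕ}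
    {f : Momentum D → ℝ} (hf : f ∈ trigPoly D N) :
    ∫ k, v k ^ 2 ∂bzMeasure D ≤
      ∑ r ∈ lenBall D N, coeff v r ^ 2 + ∫ k, (v k - f k) ^ 2 ∂bzMeasure D := by
  set p := fourierSum N v
  have hp := fourierSum_mem_trigPoly N v
  have hpc : Continuous p := continuous_of_mem_trigPoly hp
  have hfc := continuous_of_mem_trigPoly hf
  have horth (g : Momentum D → ℝ) (hg : g ∈ trigPoly D N) :
      ∫ k, g k * (v k - p k) ∂bzMeasure D = 0 :=
    integral_mul_eq_zero_of_mem_trigPoly hg (by fun_prop) fun r hr => by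
      rw [coeff_sub hv hpc, coeff_fourierSum hr, sub_self]
  have hp_sq : ∫ k, p k ^ 2 ∂bzMeasure D = ∑ r ∈ lenBall D N, coeff v r ^ 2 := by
    simp only [sq]
    rw [integral_fourierSum_mul hpc]
    exact Finset.sum_congr rfl fun r hr => by rw [coeff_fourierSum (mem_lenBall.mp hr)]
  have hv_sq := integral_sq_add_of_orthogonal hpc (by fun_prop) (horth p hp)
  have hvf_sq := integral_sq_add_of_orthogonal (hpc.sub hfc) (hv.sub hpc)
    (horth _ (Submodule.sub_mem _ hp hf))
  have hnonneg : 0 ≤ ∫ k, (p k - f k) ^ 2 ∂bzMeasure D := integral_nonneg fun k => sq_nonneg _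
  simp only [Pi.sub_apply, add_sub_cancel, sub_add_sub_cancel'] at hv_sq hvf_sq
  linarith

lemma integral_sq_le_of_forall_sum_sq_coeff_le {v : Momentum D → ℝ} (hv : Continuous v)
    (happrox : ∀ ε > 0, ∃ N, ∃ f ∈ trigPoly D N, ∀ k, |v k - f k| ≤ ε) {s : ℝ}
    (hs : ∀ F : Finset (Site D), ∑ r ∈ F, coeff v r ^ 2 ≤ s) :
    ∫ k, v k ^ 2 ∂bzMeasure D ≤ s := by
  refine le_of_forall_pos_le_add fun ε hε => ?_
  obtain ⟨N, f, hf, hvf⟩ := happrox (√ε) (Real.sqrt_pos.mpr hε)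
  have hfc := continuous_of_mem_trigPoly hf
  have herr : ∫ k, (v k - f k) ^ 2 ∂bzMeasure D ≤ ∫ _, ε ∂bzMeasure D :=
    integral_mono (integrable_bzMeasure (by fun_prop)) (integrable_const ε) fun k => by
      simpa only [sq_abs, Real.sq_sqrt hε.le] using pow_le_pow_left₀ (abs_nonneg _) (hvf k) 2
  rw [integral_const, probReal_univ, one_smul] at herr
  linarith [integral_sq_le_sum_sq_coeff_add hv hf, hs (lenBall D N)]

end TrigonometricPolynomials

/-! ### Bloch dynamical matrices and Bogoliubov transformations -/

section Diagonalization

variable {n S : Type*} [Fintype n] [DecidableEq n] [CommRing S]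

lemma trace_eq_sum_of_mul_eq_mul_diagonal {A L : Matrix n n S} {e : n → S} (hL : IsUnit L.det)
    (h : A * L = L * Matrix.diagonal e) : A.trace = ∑ i, e i := by
  rw [← Matrix.mul_nonsing_inv_cancel_right L A hL, h, Matrix.trace_mul_comm,
    Matrix.nonsing_inv_mul_cancel_left L _ hL, Matrix.trace_diagonal]

lemma det_eq_prod_of_mul_eq_mul_diagonal {A L : Matrix n n S} {e : n → S} (hL : IsUnit L.det)
    (h : A * L = L * Matrix.diagonal e) : A.det = ∏ i, e i := by
  have hdet := congrArg Matrix.det h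
  rw [Matrix.det_mul, Matrix.det_mul, Matrix.det_diagonal, mul_comm] at hdet
  exact hL.mul_left_cancel hdet

lemma eq_smul_one_of_mul_eq_mul_diagonal {A L : Matrix n n S} {c : S} (hL : IsUnit L.det)
    (h : A * L = L * Matrix.diagonal fun _ => c) : A = c • 1 := by
  rw [← Matrix.mul_nonsing_inv_cancel_right L A hL, h, ← Matrix.smul_one_eq_diagonal,
    Matrix.mul_smul, Matrix.mul_one, Matrix.smul_mul, Matrix.mul_nonsing_inv L hL]

end Diagonalization

section NambuSpace

lemma τ₃_mul_τ₃ : τ₃ * τ₃ = 1 := by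
  simp [τ₃, Matrix.one_fin_two]

lemma conjTranspose_quadU_mul_mul_quadU (a b c d : ℂ) :
    quadUᴴ * !![a, b; c, d] * quadU = (1 / 2 : ℂ) •
      !![a + b + c + d, Complex.I * (a - b + c - d);
        -Complex.I * (a + b - c - d), a - b - c + d] := by
  have h : star ((√2 : ℝ) : ℂ)⁻¹ * ((√2 : ℝ) : ℂ)⁻¹ = 1 / 2 := by
    norm_num [← mul_inv, ← Complex.ofReal_mul]
  rw [quadU, Matrix.conjTranspose_smul, Matrix.smul_mul, Matrix.smul_mul, Matrix.mul_smul,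
    smul_smul, h]
  congr 1
  ext i j
  fin_cases i <;> fin_cases j <;> simp [Matrix.mul_apply, Fin.sum_univ_two]
  · ring
  · ring
  · ring
  · linear_combination (b + c - a - d) * Complex.I_sq

lemma conjTranspose_quadU_mul_quadU : quadUᴴ * quadU = 1 := by
  have h := conjTranspose_quadU_mul_mul_quadU 1 0 0 1
  rw [← Matrix.one_fin_two, Matrix.mul_one] at h
  rw [h, Matrix.one_fin_two]
  norm_num

lemma quadU_mul_conjTranspose : quadU * quadUᴴ = 1 :=
  mul_eq_one_comm.mp conjTranspose_quadU_mul_quadU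

lemma conjTranspose_quadU_mul_τ₃_mul_quadU :
    quadUᴴ * τ₃ * quadU = !![0, Complex.I; -Complex.I, 0] := by
  rw [τ₃, conjTranspose_quadU_mul_mul_quadU]
  ext i j
  fin_cases i <;> fin_cases j <;> simp <;> ring

/-- The Bogoliubov matrix that squeezes the quadratures by `t⁻¹` and `t`; its entries are the
hyperbolic cosine and sine of `-log t`. -/
def squeeze (t : ℝ) : Matrix (Fin 2) (Fin 2) ℂ :=
  !![(((t⁻¹ + t) / 2 : ℝ) : ℂ), (((t⁻¹ - t) / 2 : ℝ) : ℂ);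
    (((t⁻¹ - t) / 2 : ℝ) : ℂ), (((t⁻¹ + t) / 2 : ℝ) : ℂ)]

lemma map_conj_squeeze (t : ℝ) : (squeeze t).map (starRingEnd ℂ) = τ₁ * squeeze t * τ₁ := by
  ext i j
  fin_cases i <;> fin_cases j <;> simp only [squeeze, τ₁, Matrix.map_apply] <;>
    simp [Matrix.mul_apply, Fin.sum_univ_two, -Complex.ofReal_div]

lemma conjTranspose_squeeze_mul_τ₃_mul_squeeze {t : ℝ} (ht : t ≠ 0) :
    (squeeze t)ᴴ * τ₃ * squeeze t = τ₃ := by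
  have ht' : (t : ℂ) ≠ 0 := Complex.ofReal_ne_zero.mpr ht
  ext i j
  fin_cases i <;> fin_cases j <;>
    simp [squeeze, τ₃, Matrix.mul_apply, Fin.sum_univ_two, Complex.conj_ofNat] <;> field_simp <;>
    ring

end NambuSpace

lemma sum_box_eq_zero_of_odd {D N : ℕ} {f : Site D → ℝ} (hf : ∀ r, f (-r) = -f r) :
    ∑ r ∈ box D N, f r = 0 := by
  have h : ∑ r ∈ box D N, f r = ∑ r ∈ box D N, f (-r) :=
    Finset.sum_nbij' (fun r => -r) (fun r => -r) (fun _ => neg_mem_box.mpr)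
      (fun _ => neg_mem_box.mpr) (fun _ _ => neg_neg _) (fun _ _ => neg_neg _)
      (fun _ _ => by rw [neg_neg])
  simp only [hf, Finset.sum_neg_distrib] at h
  linarith

lemma exists_mem_BZ {D : ℕ} (k : Momentum D) :
    ∃ k' ∈ BZ D, ∀ r : Site D, Real.cos (dotK k' r) = Real.cos (dotK k r) := by
  have hp : (0 : ℝ) < 2 * Real.pi := Real.two_pi_pos
  refine ⟨fun μ => toIocMod hp (-Real.pi) (k μ), ?_, fun r => ?_⟩
  · have hmem (μ : Fin D) := toIocMod_mem_Ioc hp (-Real.pi) (k μ)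
    exact ⟨fun μ => (hmem μ).1.le, fun μ => (hmem μ).2.trans (by linarith)⟩
  · have hshift : dotK (fun μ => toIocMod hp (-Real.pi) (k μ)) r =
        dotK k r - ((∑ μ, toIocDiv hp (-Real.pi) (k μ) * r μ : ℤ) : ℝ) * (2 * Real.pi) := by
      simp only [dotK, toIocMod, zsmul_eq_mul]
      push_cast
      rw [Finset.sum_mul, ← Finset.sum_sub_distrib]
      exact Finset.sum_congr rfl fun μ _ => by ring
    rw [hshift, Real.cos_sub_int_mul_two_pi]

namespace QBH

variable {D R : ℕ} (H : QBH D R)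

/-- The odd part of `K(k)`, which drifts both branches of the spectrum of `g(k)` alike. -/
def eta (k : Momentum D) : ℝ := -∑ r ∈ box D R, (H.K r).im * Real.sin (dotK k r)

lemma eta_neg (k : Momentum D) : H.eta (-k) = -H.eta k := by simp [eta]

lemma X_neg (k : Momentum D) : H.X (-k) = H.X k := by simp [X, symbol]

lemma P_neg (k : Momentum D) : H.P (-k) = H.P k := by simp [P, symbol]

lemma exp_I_mul_mul (x : ℝ) (z : ℂ) : Complex.exp (Complex.I * x) * z =
    ((z.re * Real.cos x - z.im * Real.sin x : ℝ) : ℂ) +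
      ((z.re * Real.sin x + z.im * Real.cos x : ℝ) : ℂ) * Complex.I := by
  rw [mul_comm Complex.I, Complex.exp_ofReal_mul_I]
  apply Complex.ext <;> simp [-Complex.ofReal_cos, -Complex.ofReal_sin] <;> ring

lemma Khat_eq (k : Momentum D) : H.Khat k = (((H.X k + H.P k) / 2 + H.eta k : ℝ) : ℂ) := by
  have hodd : ∑ r ∈ box D R,
      ((H.K r).re * Real.sin (dotK k r) + (H.K r).im * Real.cos (dotK k r)) = 0 :=
    sum_box_eq_zero_of_odd fun r => by simp [H.K_neg]; ring
  have heven : (H.X k + H.P k) / 2 = ∑ r ∈ box D R, (H.K r).re * Real.cos (dotK k r) := by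
    rw [X, P, symbol, symbol, ← Finset.sum_add_distrib, Finset.sum_div]
    exact Finset.sum_congr rfl fun r _ => by simp [Hxx, Hpp]; ring
  simp only [Khat, exp_I_mul_mul]
  rw [Finset.sum_add_distrib, ← Finset.sum_mul, ← Complex.ofReal_sum, ← Complex.ofReal_sum, hodd,
    Finset.sum_sub_distrib, heven, eta]
  simp [sub_eq_add_neg]

variable {H}

lemma im_Δ_eq_zero (hxp : H.Hxp + H.Hxpᵀ = 0) (r : Site D) : (H.Δ r).im = 0 := by
  have h := congrFun (congrFun hxp 0) r
  simp only [Matrix.add_apply, Matrix.transpose_apply, Hxp, Matrix.of_apply, sub_zero, zero_sub,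
    Matrix.zero_apply, H.K_neg, H.Δ_neg, Complex.sub_im, Complex.conj_im] at h
  linarith

lemma Δhat_eq (hxp : H.Hxp + H.Hxpᵀ = 0) (k : Momentum D) :
    H.Δhat k = (((H.X k - H.P k) / 2 : ℝ) : ℂ) := by
  have hodd : ∑ r ∈ box D R, (H.Δ r).re * Real.sin (dotK k r) = 0 :=
    sum_box_eq_zero_of_odd fun r => by simp [H.Δ_neg]
  have heven : (H.X k - H.P k) / 2 = ∑ r ∈ box D R, (H.Δ r).re * Real.cos (dotK k r) := by
    rw [X, P, symbol, symbol, ← Finset.sum_sub_distrib, Finset.sum_div]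
    exact Finset.sum_congr rfl fun r _ => by simp [Hxx, Hpp]; ring
  simp only [Δhat, exp_I_mul_mul, im_Δ_eq_zero hxp, zero_mul, sub_zero, add_zero]
  rw [Finset.sum_add_distrib, ← Finset.sum_mul, ← Complex.ofReal_sum, ← Complex.ofReal_sum, hodd,
    heven]
  simp

lemma g_eq (hxp : H.Hxp + H.Hxpᵀ = 0) (k : Momentum D) :
    H.g k = !![(((H.X k + H.P k) / 2 + H.eta k : ℝ) : ℂ), (((H.X k - H.P k) / 2 : ℝ) : ℂ);
      -(((H.X k - H.P k) / 2 : ℝ) : ℂ), (((-(H.X k + H.P k)) / 2 + H.eta k : ℝ) : ℂ)] := by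
  rw [g, Khat_eq, Khat_eq, Δhat_eq hxp, Δhat_eq hxp, Complex.conj_ofReal, Complex.conj_ofReal,
    X_neg, P_neg, eta_neg]
  push_cast
  ring_nf

lemma conjTranspose_quadU_mul_g_mul_quadU (hxp : H.Hxp + H.Hxpᵀ = 0) (k : Momentum D) :
    quadUᴴ * H.g k * quadU =
      !![(H.eta k : ℂ), Complex.I * H.P k; -Complex.I * H.X k, (H.eta k : ℂ)] := by
  rw [g_eq hxp, conjTranspose_quadU_mul_mul_quadU]
  ext i j
  fin_cases i <;> fin_cases j <;> simp <;> ring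

lemma trace_g (hxp : H.Hxp + H.Hxpᵀ = 0) (k : Momentum D) :
    (H.g k).trace = ((2 * H.eta k : ℝ) : ℂ) := by
  rw [g_eq hxp, Matrix.trace_fin_two_of]
  push_cast
  ring

lemma det_g (hxp : H.Hxp + H.Hxpᵀ = 0) (k : Momentum D) :
    (H.g k).det = ((H.eta k ^ 2 - H.X k * H.P k : ℝ) : ℂ) := by
  rw [g_eq hxp, Matrix.det_fin_two_of]
  push_cast
  ring

lemma energies_of_g_mul_eq (hxp : H.Hxp + H.Hxpᵀ = 0) {k : Momentum D}
    {L : Matrix (Fin 2) (Fin 2) ℂ} (hL : IsUnit L.det) {e : Fin 2 → ℝ}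
    (h : H.g k * L = L * Matrix.diagonal fun n => (e n : ℂ)) :
    e 0 + e 1 = 2 * H.eta k ∧ (e 0 - e 1) ^ 2 = 4 * (H.X k * H.P k) := by
  have htr := trace_eq_sum_of_mul_eq_mul_diagonal hL h
  have hdet := det_eq_prod_of_mul_eq_mul_diagonal hL h
  rw [trace_g hxp, Fin.sum_univ_two] at htr
  rw [det_g hxp, Fin.prod_univ_two] at hdet
  norm_cast at htr hdet
  exact ⟨htr.symm, by linear_combination 4 * hdet - (2 * H.eta k + e 0 + e 1) * htr⟩

lemma X_mul_P_nonneg (hxp : H.Hxp + H.Hxpᵀ = 0) (hs : H.DynamicallyStable) (k : Momentum D) :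
    0 ≤ H.X k * H.P k := by
  obtain ⟨S, e, hS, h⟩ := hs k
  linarith [(energies_of_g_mul_eq hxp hS h).2, sq_nonneg (e 0 - e 1)]

lemma isQuasiparticleEnergy_eta (hxp : H.Hxp + H.Hxpᵀ = 0) (hs : H.DynamicallyStable)
    {k : Momentum D} (h0 : H.X k * H.P k = 0) : H.IsQuasiparticleEnergy k (H.eta k) := by
  obtain ⟨S, e, hS, h⟩ := hs k
  obtain ⟨hsum, hdiff⟩ := energies_of_g_mul_eq hxp hS h
  have he : e 0 = e 1 := by
    rw [h0, mul_zero] at hdiff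
    exact sub_eq_zero.mp (pow_eq_zero_iff two_ne_zero |>.mp hdiff)
  have hconst : (fun n => (e n : ℂ)) = fun _ => (H.eta k : ℂ) := by
    funext n
    rw [show e n = H.eta k by fin_cases n <;> simp <;> linarith]
  rw [hconst] at h
  refine ⟨![1, 0], ?_, by simp [τ₃]⟩
  rw [eq_smul_one_of_mul_eq_mul_diagonal hS h, Matrix.smul_mulVec, Matrix.one_mulVec]

lemma isQuasiparticleEnergy_of_g_mul_eq {k : Momentum D} {L : Matrix (Fin 2) (Fin 2) ℂ}
    {e : Fin 2 → ℂ} {ω : ℝ} (hω : e 0 = ω) (hL : Lᴴ * τ₃ * L = τ₃)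
    (h : H.g k * L = L * Matrix.diagonal e) : H.IsQuasiparticleEnergy k ω := by
  refine ⟨L.col 0, ?_, ?_⟩
  · rw [← Matrix.mulVec_single_one, Matrix.mulVec_mulVec, h, ← Matrix.mulVec_mulVec,
      Matrix.diagonal_mulVec_single, hω, mul_one, ← Matrix.mulVec_smul]
    congr 1
    ext i; fin_cases i <;> simp
  · calc star (L.col 0) ⬝ᵥ (τ₃ *ᵥ L.col 0) = (Lᴴ * τ₃ * L) 0 0 :=
          (Matrix.mul_mul_apply Lᴴ τ₃ L 0 0).symm
      _ = 1 := by rw [hL]; simp [τ₃]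

/-- The squeezing that symmetrizes `X(k)` and `P(k)`. -/
def squeezing (H : QBH D R) (k : Momentum D) : ℝ := √√(H.X k / H.P k)

lemma squeezing_neg (k : Momentum D) : H.squeezing (-k) = H.squeezing k := by
  rw [squeezing, X_neg, P_neg, squeezing]

lemma squeezing_pos {k : Momentum D} (h : 0 < H.X k * H.P k) : 0 < H.squeezing k :=
  Real.sqrt_pos.mpr (Real.sqrt_pos.mpr (div_pos_iff.mpr (mul_pos_iff.mp h)))

lemma P_mul_squeezing_pow {k : Momentum D} (h : 0 < H.X k * H.P k) :
    H.P k * H.squeezing k ^ 4 = H.X k := by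
  rw [squeezing, show 4 = 2 * 2 from rfl, pow_mul, Real.sq_sqrt (Real.sqrt_nonneg _),
    Real.sq_sqrt (div_pos_iff.mpr (mul_pos_iff.mp h)).le,
    mul_div_cancel₀ _ (right_ne_zero_of_mul h.ne')]

lemma g_mul_squeeze (hxp : H.Hxp + H.Hxpᵀ = 0) {k : Momentum D} (h : 0 < H.X k * H.P k) :
    H.g k * squeeze (H.squeezing k) = squeeze (H.squeezing k) * Matrix.diagonal
      ![((H.eta k + H.P k * H.squeezing k ^ 2 : ℝ) : ℂ),
        -((H.eta (-k) + H.P (-k) * H.squeezing (-k) ^ 2 : ℝ) : ℂ)] := by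
  have ht : (H.squeezing k : ℂ) ≠ 0 := Complex.ofReal_ne_zero.mpr (squeezing_pos h).ne'
  rw [g_eq hxp, ← P_mul_squeezing_pow h, eta_neg, P_neg, squeezing_neg, squeeze]
  ext i j
  fin_cases i <;> fin_cases j <;> simp [Matrix.mul_apply, Fin.sum_univ_two] <;> field_simp <;> ring

lemma nonempty_bogoliubov (hxp : H.Hxp + H.Hxpᵀ = 0) (hpos : ∀ k, 0 < H.X k * H.P k) :
    Nonempty H.Bogoliubov :=
  ⟨{ L := fun k => squeeze (H.squeezing k)
     ω := fun k => H.eta k + H.P k * H.squeezing k ^ 2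
     conj_L := fun k => by rw [squeezing_neg, map_conj_squeeze]
     pseudoUnitary := fun k => conjTranspose_squeeze_mul_τ₃_mul_squeeze (squeezing_pos (hpos k)).ne'
     diagonalizes := fun k => g_mul_squeeze hxp (hpos k) }⟩

lemma isQuasiparticleEnergy_eta_add (hxp : H.Hxp + H.Hxpᵀ = 0) {k : Momentum D}
    (h : 0 < H.X k * H.P k) :
    H.IsQuasiparticleEnergy k (H.eta k + H.P k * H.squeezing k ^ 2) :=
  isQuasiparticleEnergy_of_g_mul_eq rfl
    (conjTranspose_squeeze_mul_τ₃_mul_squeeze (squeezing_pos h).ne') (g_mul_squeeze hxp h)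

lemma kreinGap_le {k : Momentum D} (hk : k ∈ BZ D) {ω ω' : ℝ}
    (h : H.IsQuasiparticleEnergy k ω) (h' : H.IsQuasiparticleEnergy (-k) ω') :
    H.kreinGap ≤ |ω + ω'| := by
  refine csInf_le ⟨0, ?_⟩ ⟨k, hk, ω, ω', h, h', rfl⟩
  rintro x ⟨-, -, -, -, -, -, rfl⟩
  exact abs_nonneg _

lemma kreinGap_nonneg : 0 ≤ H.kreinGap := by
  refine Real.sInf_nonneg ?_
  rintro x ⟨-, -, -, -, -, -, rfl⟩
  exact abs_nonneg _

lemma sq_kreinGap_le_of_mem_BZ (hxp : H.Hxp + H.Hxpᵀ = 0) (hs : H.DynamicallyStable)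
    {k : Momentum D} (hk : k ∈ BZ D) : H.kreinGap ^ 2 ≤ 4 * (H.X k * H.P k) := by
  rcases (X_mul_P_nonneg hxp hs k).eq_or_lt' with h | h
  · have hle := kreinGap_le hk (isQuasiparticleEnergy_eta hxp hs h)
      (isQuasiparticleEnergy_eta hxp hs (k := -k) (by rwa [X_neg, P_neg]))
    rw [eta_neg, add_neg_cancel, abs_zero] at hle
    rw [h, hle.antisymm kreinGap_nonneg]
    norm_num
  · have hle := kreinGap_le hk (isQuasiparticleEnergy_eta_add hxp h)
      (isQuasiparticleEnergy_eta_add hxp (k := -k) (by rwa [X_neg, P_neg]))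
    rw [eta_neg, P_neg, squeezing_neg] at hle
    calc H.kreinGap ^ 2 ≤ _ := pow_le_pow_left₀ kreinGap_nonneg hle 2
      _ = 4 * (H.P k * H.squeezing k ^ 4 * H.P k) := by rw [sq_abs]; ring
      _ = 4 * (H.X k * H.P k) := by rw [P_mul_squeezing_pow h]

theorem sq_kreinGap_le (hxp : H.Hxp + H.Hxpᵀ = 0) (hs : H.DynamicallyStable) (k : Momentum D) :
    H.kreinGap ^ 2 ≤ 4 * (H.X k * H.P k) := by
  obtain ⟨k', hk', hcos⟩ := exists_mem_BZ k
  simpa only [X, P, symbol, hcos] using sq_kreinGap_le_of_mem_BZ hxp hs hk'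

lemma X_mul_P_pos (hxp : H.Hxp + H.Hxpᵀ = 0) (hs : H.DynamicallyStable)
    (hgap : 0 < H.kreinGap) (k : Momentum D) : 0 < H.X k * H.P k := by
  linarith [sq_kreinGap_le hxp hs k, sq_pos_of_pos hgap]

namespace Bogoliubov

lemma isUnit_det (Q : H.Bogoliubov) (k : Momentum D) : IsUnit (Q.L k).det := by
  have h := congrArg Matrix.det (Q.pseudoUnitary k)
  refine isUnit_iff_ne_zero.mpr fun h0 => ?_
  simp [Matrix.det_mul, h0, τ₃, Matrix.det_fin_two] at h

lemma mul_τ₃_mul_conjTranspose (Q : H.Bogoliubov) (k : Momentum D) :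
    Q.L k * τ₃ * (Q.L k)ᴴ = τ₃ := by
  have h : τ₃ * (Q.L k)ᴴ * τ₃ * Q.L k = 1 := by
    rw [Matrix.mul_assoc, Matrix.mul_assoc, ← Matrix.mul_assoc _ τ₃, Q.pseudoUnitary, τ₃_mul_τ₃]
  calc Q.L k * τ₃ * (Q.L k)ᴴ = Q.L k * (τ₃ * (Q.L k)ᴴ * τ₃) * τ₃ := by
        simp only [Matrix.mul_assoc, τ₃_mul_τ₃, Matrix.mul_one]
    _ = τ₃ := by rw [mul_eq_one_comm.mp h, Matrix.one_mul]

/-- The momentum-space covariance matrix of the quasiparticle vacuum, in quadratures. -/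
def cov (Q : H.Bogoliubov) (k : Momentum D) : Matrix (Fin 2) (Fin 2) ℂ :=
  quadUᴴ * Q.L k * (Q.L k)ᴴ * quadU

open scoped ComplexOrder in
lemma posSemidef_cov (Q : H.Bogoliubov) (k : Momentum D) : (Q.cov k).PosSemidef := by
  have h : Q.cov k = quadUᴴ * Q.L k * (quadUᴴ * Q.L k)ᴴ := by
    simp [cov, Matrix.conjTranspose_mul, Matrix.mul_assoc]
  exact h ▸ Matrix.posSemidef_self_mul_conjTranspose _

lemma energies (hxp : H.Hxp + H.Hxpᵀ = 0) (Q : H.Bogoliubov) (k : Momentum D) :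
    Q.ω k - Q.ω (-k) = 2 * H.eta k ∧ (Q.ω k + Q.ω (-k)) ^ 2 = 4 * (H.X k * H.P k) := by
  have he : ![(Q.ω k : ℂ), -(Q.ω (-k) : ℂ)] = fun n => ((![Q.ω k, -Q.ω (-k)] n : ℝ) : ℂ) := by
    funext n
    fin_cases n <;> simp
  simpa [← sub_eq_add_neg] using energies_of_g_mul_eq (e := ![Q.ω k, -Q.ω (-k)]) hxp
    (Q.isUnit_det k) (he ▸ Q.diagonalizes k)

lemma g_eq_smul_one_add (Q : H.Bogoliubov) (k : Momentum D) :
    H.g k = (((Q.ω k - Q.ω (-k)) / 2 : ℝ) : ℂ) • (1 : Matrix (Fin 2) (Fin 2) ℂ) +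
      (((Q.ω k + Q.ω (-k)) / 2 : ℝ) : ℂ) • (Q.L k * (Q.L k)ᴴ * τ₃) := by
  have hsplit : Matrix.diagonal ![(Q.ω k : ℂ), -(Q.ω (-k) : ℂ)] =
      (((Q.ω k - Q.ω (-k)) / 2 : ℝ) : ℂ) • (1 : Matrix (Fin 2) (Fin 2) ℂ) +
        (((Q.ω k + Q.ω (-k)) / 2 : ℝ) : ℂ) • τ₃ := by
    ext i j
    fin_cases i <;> fin_cases j <;> simp [τ₃] <;> ring
  have hinv : Q.L k * (τ₃ * (Q.L k)ᴴ * τ₃) = 1 := by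
    rw [← Matrix.mul_assoc, ← Matrix.mul_assoc, mul_τ₃_mul_conjTranspose, τ₃_mul_τ₃]
  calc H.g k = H.g k * Q.L k * (τ₃ * (Q.L k)ᴴ * τ₃) := by
        rw [Matrix.mul_assoc, hinv, Matrix.mul_one]
    _ = (((Q.ω k - Q.ω (-k)) / 2 : ℝ) : ℂ) • (Q.L k * (τ₃ * (Q.L k)ᴴ * τ₃)) +
        (((Q.ω k + Q.ω (-k)) / 2 : ℝ) : ℂ) • (Q.L k * (τ₃ * τ₃) * (Q.L k)ᴴ * τ₃) := by
        rw [Q.diagonalizes, hsplit]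
        simp only [Matrix.mul_add, Matrix.add_mul, Matrix.mul_smul, Matrix.smul_mul,
          Matrix.mul_one, Matrix.mul_assoc]
    _ = _ := by rw [hinv, τ₃_mul_τ₃, Matrix.mul_one]

lemma quadU_g_eq_smul_one_add (Q : H.Bogoliubov) (k : Momentum D) :
    quadUᴴ * H.g k * quadU =
      (((Q.ω k - Q.ω (-k)) / 2 : ℝ) : ℂ) • (1 : Matrix (Fin 2) (Fin 2) ℂ) +
        (((Q.ω k + Q.ω (-k)) / 2 : ℝ) : ℂ) •
          (Q.cov k * !![0, Complex.I; -Complex.I, 0]) := by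
  have hcov : Q.cov k * !![0, Complex.I; -Complex.I, 0] =
      quadUᴴ * (Q.L k * (Q.L k)ᴴ * τ₃) * quadU := by
    rw [← conjTranspose_quadU_mul_τ₃_mul_quadU, cov]
    simp only [Matrix.mul_assoc]
    rw [← Matrix.mul_assoc quadU, quadU_mul_conjTranspose, Matrix.one_mul]
  rw [hcov, Q.g_eq_smul_one_add, Matrix.mul_add, Matrix.add_mul, Matrix.mul_smul, Matrix.smul_mul,
    Matrix.mul_one, conjTranspose_quadU_mul_quadU, Matrix.mul_smul, Matrix.smul_mul]

lemma smul_cov (hxp : H.Hxp + H.Hxpᵀ = 0) (Q : H.Bogoliubov) (k : Momentum D) :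
    (((Q.ω k + Q.ω (-k)) / 2 : ℝ) : ℂ) • Q.cov k = !![(H.P k : ℂ), 0; 0, (H.X k : ℂ)] := by
  have hσ : !![0, Complex.I; -Complex.I, 0] * !![0, Complex.I; -Complex.I, 0] = 1 := by
    simp [Matrix.one_fin_two]
  have hη : (Q.ω k - Q.ω (-k)) / 2 = H.eta k := by linarith [(Q.energies hxp k).1]
  have hgσ : (((Q.ω k + Q.ω (-k)) / 2 : ℝ) : ℂ) • (Q.cov k * !![0, Complex.I; -Complex.I, 0]) =
      !![0, Complex.I * H.P k; -Complex.I * H.X k, 0] := by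
    rw [← add_right_inj ((H.eta k : ℂ) • (1 : Matrix (Fin 2) (Fin 2) ℂ)), ← hη,
      ← Q.quadU_g_eq_smul_one_add, conjTranspose_quadU_mul_g_mul_quadU hxp, hη]
    simp [Matrix.one_fin_two]
  calc _ = (((Q.ω k + Q.ω (-k)) / 2 : ℝ) : ℂ) • (Q.cov k * !![0, Complex.I; -Complex.I, 0]) *
        !![0, Complex.I; -Complex.I, 0] := by
        rw [Matrix.smul_mul, Matrix.mul_assoc, hσ, Matrix.mul_one]
    _ = _ := by
        rw [hgσ]
        ext i j
        fin_cases i <;> fin_cases j <;> simp [mul_right_comm _ _ Complex.I]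

open scoped ComplexOrder in
theorem cov_eq (hxp : H.Hxp + H.Hxpᵀ = 0) (hpos : ∀ k, 0 < H.X k * H.P k)
    (Q : H.Bogoliubov) (k : Momentum D) :
    Q.cov k = !![(((H.X k / H.P k) ^ (-(1 / 2) : ℝ) : ℝ) : ℂ), 0;
      0, (((H.X k / H.P k) ^ (1 / 2 : ℝ) : ℝ) : ℂ)] := by
  set μ := (Q.ω k + Q.ω (-k)) / 2 with hμ
  have hμsq : μ ^ 2 = H.X k * H.P k := by linear_combination (Q.energies hxp k).2 / 4
  have hμ0 : μ ≠ 0 := by rintro h0; nlinarith [hpos k]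
  have hcov : Q.cov k = !![((H.P k / μ : ℝ) : ℂ), 0; 0, ((H.X k / μ : ℝ) : ℂ)] := by
    have hμ0' : (μ : ℂ) ≠ 0 := Complex.ofReal_ne_zero.mpr hμ0
    rw [← inv_smul_smul₀ hμ0' (Q.cov k), hμ, Q.smul_cov hxp]
    ext i j
    fin_cases i <;> fin_cases j <;> simp [div_eq_inv_mul]
  have hX : 0 ≤ H.X k / μ := by
    rw [← Complex.zero_le_real]
    simpa [hcov] using (Q.posSemidef_cov k).diag_nonneg (i := 1)
  have hdiv : H.X k / H.P k = (H.X k / μ) ^ 2 := by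
    rw [div_pow, hμsq, sq, mul_div_mul_left _ _ (left_ne_zero_of_mul (hpos k).ne')]
  have hsqrt : (H.X k / H.P k) ^ (1 / 2 : ℝ) = H.X k / μ := by
    rw [hdiv, ← Real.sqrt_eq_rpow, Real.sqrt_sq hX]
  have hinv : (H.X k / H.P k) ^ (-(1 / 2) : ℝ) = H.P k / μ := by
    rw [Real.rpow_neg (hdiv ▸ sq_nonneg _), hsqrt, inv_div,
      div_eq_div_iff (left_ne_zero_of_mul (hpos k).ne') hμ0, ← sq, hμsq, mul_comm]
  rw [hcov, hsqrt, hinv]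

lemma Γ_eq_harmonicΓ (hxp : H.Hxp + H.Hxpᵀ = 0) (hpos : ∀ k, 0 < H.X k * H.P k)
    (Q : H.Bogoliubov) : Q.Γ = harmonicΓ fun k => H.X k / H.P k :=
  congrArg realSpaceCov (funext (Q.cov_eq hxp hpos))

end Bogoliubov

end QBH

/-! ### Exponential decay of correlations -/

/-- A pair of positive trigonometric polynomials of degree `R`, bounded by `a` and `b`, with
product bounded from below by `(E / 2)²`. Up to a common sign, this is what the symbols of `H_xx`
and `H_pp` are. -/
structure GappedPair (D R : ℕ) (x p : Momentum D → ℝ) (a b E : ℝ) : Prop where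
  mem_left : x ∈ trigPoly D R
  mem_right : p ∈ trigPoly D R
  pos_left : ∀ k, 0 < x k
  pos_right : ∀ k, 0 < p k
  le_left : ∀ k, x k ≤ a
  le_right : ∀ k, p k ≤ b
  gap_pos : 0 < E
  gap_le : ∀ k, E ^ 2 ≤ 4 * (x k * p k)

lemma one_sub_div_one_add_le_exp {s : ℝ} (h0 : 0 ≤ s) (h1 : s ≤ 1) :
    (1 - s) / (1 + s) ≤ Real.exp (-s) := by
  have h : (1 - s) / (1 + s) ≤ 1 - s := div_le_self (by linarith) (by linarith)
  linarith [Real.add_one_le_exp (-s)]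

namespace GappedPair

variable {D R : ℕ} {x p : Momentum D → ℝ} {a b E : ℝ}

lemma symm (h : GappedPair D R x p a b E) : GappedPair D R p x b a E :=
  ⟨h.mem_right, h.mem_left, h.pos_right, h.pos_left, h.le_right, h.le_left, h.gap_pos,
    fun k => by rw [mul_comm (p k)]; exact h.gap_le k⟩

lemma left_pos (h : GappedPair D R x p a b E) : 0 < a := (h.pos_left 0).trans_le (h.le_left 0)

lemma sqrt_mul_pos (h : GappedPair D R x p a b E) : 0 < √(a * b) :=
  Real.sqrt_pos.mpr (mul_pos h.left_pos h.symm.left_pos)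

lemma mul_le (h : GappedPair D R x p a b E) (k : Momentum D) : x k * p k ≤ a * b :=
  mul_le_mul (h.le_left k) (h.le_right k) (h.pos_right k).le h.left_pos.le

lemma half_gap_le_sqrt (h : GappedPair D R x p a b E) (k : Momentum D) :
    E / 2 ≤ √(x k * p k) :=
  Real.le_sqrt_of_sq_le (by linarith [h.gap_le k])

lemma gap_le_sqrt (h : GappedPair D R x p a b E) : E ≤ 2 * √(a * b) := by
  linarith [h.half_gap_le_sqrt 0, Real.sqrt_le_sqrt (h.mul_le 0)]

lemma continuous_sqrt_div (h : GappedPair D R x p a b E) : Continuous fun k => √(x k / p k) :=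
  ((continuous_of_mem_trigPoly h.mem_left).div (continuous_of_mem_trigPoly h.mem_right)
    fun k => (h.pos_right k).ne').sqrt

lemma sqrt_div_eq (h : GappedPair D R x p a b E) (k : Momentum D) :
    √(x k / p k) = x k * (1 / √(x k * p k)) := by
  rw [← mul_div_mul_left _ _ (h.pos_left k).ne', ← sq, Real.sqrt_div (sq_nonneg _),
    Real.sqrt_sq (h.pos_left k).le, mul_one_div]

lemma sqrt_div_le (h : GappedPair D R x p a b E) (k : Momentum D) :
    √(x k / p k) ≤ 2 * a / E := by
  have hE := h.gap_pos
  calc √(x k / p k) = x k * (1 / √(x k * p k)) := h.sqrt_div_eq k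
    _ ≤ a * (1 / (E / 2)) := by
      gcongr
      exacts [h.left_pos.le, h.le_left k, h.half_gap_le_sqrt k]
    _ = 2 * a / E := by field_simp

/-- The decay rate of the approximation error of `√(x / p)` in the degree of the polynomial in
`x p` that approximates `(x p)^{-1/2}`. -/
def rate (a b E : ℝ) : ℝ := E / (4 * √(a * b))

lemma rate_pos (h : GappedPair D R x p a b E) : 0 < rate a b E :=
  div_pos h.gap_pos (mul_pos four_pos h.sqrt_mul_pos)

lemma rate_le_half (h : GappedPair D R x p a b E) : rate a b E ≤ 1 / 2 := by
  rw [rate, div_le_iff₀ (mul_pos four_pos h.sqrt_mul_pos)]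
  linarith [h.gap_le_sqrt]

lemma exists_polynomial_approx (h : GappedPair D R x p a b E) (n : ℕ) :
    ∃ q ∈ Polynomial.degreeLT ℝ n, ∀ k, |√(x k / p k) - x k * q.eval (x k * p k)| ≤
      4 * a / E * Real.exp (-(rate a b E * n)) := by
  have hE := h.gap_pos
  have ha := h.left_pos
  set N := √(a * b) with hN
  have hN0 : 0 < N := h.sqrt_mul_pos
  have hEN : E / 4 < N := by linarith [h.gap_le_sqrt]
  have hmM : (E / 4) ^ 2 < a * b := (Real.lt_sqrt (by positivity)).mp hEN
  obtain ⟨q, hq, hqa⟩ := exists_polynomial_approx_inv_sqrt (by positivity) hmM n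
  rw [Real.sqrt_sq (by positivity), ← hN] at hqa
  have hratio : (N - E / 4) / (N + E / 4) = (1 - rate a b E) / (1 + rate a b E) := by
    rw [rate, ← hN]; field_simp
  have hρ := one_sub_div_one_add_le_exp h.rate_pos.le (h.rate_le_half.trans (by norm_num))
  have hρ0 : 0 ≤ (1 - rate a b E) / (1 + rate a b E) :=
    div_nonneg (by linarith [h.rate_le_half]) (by linarith [h.rate_pos])
  refine ⟨q, hq, fun k => ?_⟩
  have hmem : x k * p k ∈ Set.Icc ((E / 4) ^ 2) (a * b) :=
    ⟨by nlinarith [h.gap_le k], h.mul_le k⟩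
  calc |√(x k / p k) - x k * q.eval (x k * p k)|
      = x k * |1 / √(x k * p k) - q.eval (x k * p k)| := by
        rw [h.sqrt_div_eq k, ← mul_sub, abs_mul, abs_of_pos (h.pos_left k)]
    _ ≤ a * (((1 - rate a b E) / (1 + rate a b E)) ^ n / (E / 4)) :=
        mul_le_mul (h.le_left k) (hratio ▸ hqa _ hmem) (abs_nonneg _) ha.le
    _ ≤ a * (Real.exp (-rate a b E) ^ n / (E / 4)) := by gcongr
    _ = 4 * a / E * Real.exp (-(rate a b E * n)) := by
        rw [← Real.exp_nat_mul, mul_comm (n : ℝ), neg_mul]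
        field_simp

lemma exists_mem_trigPoly_approx (h : GappedPair D R x p a b E) {ε : ℝ} (hε : 0 < ε) :
    ∃ N, ∃ f ∈ trigPoly D N, ∀ k, |√(x k / p k) - f k| ≤ ε := by
  have hlim : Filter.Tendsto (fun n : ℕ => 4 * a / E * Real.exp (-(rate a b E * n))) Filter.atTop
      (nhds (4 * a / E * 0)) :=
    (Real.tendsto_exp_neg_atTop_nhds_zero.comp
      (tendsto_natCast_atTop_atTop.const_mul_atTop h.rate_pos)).const_mul _
  rw [mul_zero] at hlim
  obtain ⟨n, hn⟩ := (hlim.eventually (ge_mem_nhds hε)).exists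
  obtain ⟨q, hq, hqa⟩ := h.exists_polynomial_approx n
  exact ⟨_, _, mul_eval_mem_trigPoly h.mem_left (mul_mem_trigPoly h.mem_left h.mem_right) hq,
    fun k => (hqa k).trans hn⟩

lemma abs_coeff_le_exp_of_lt (h : GappedPair D R x p a b E) {n : ℕ} {r : Site D}
    (hn : 2 * R * n < len r + R) :
    |coeff (fun k => √(x k / p k)) r| ≤ 4 * a / E * Real.exp (-(rate a b E * n)) := by
  rcases n with _ | m
  · refine abs_coeff_le (fun k => ?_) r
    rw [abs_of_nonneg (Real.sqrt_nonneg _)]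
    refine (h.sqrt_div_le k).trans ?_
    have := h.gap_pos
    have := h.left_pos
    simp only [Nat.cast_zero, mul_zero, neg_zero, Real.exp_zero, mul_one]
    gcongr
    norm_num
  · obtain ⟨q, hq, hqa⟩ := h.exists_polynomial_approx (m + 1)
    have hf := mul_eval_mem_trigPoly h.mem_left (mul_mem_trigPoly h.mem_left h.mem_right) hq
    have hdeg : R + (m + 1 - 1) * (R + R) < len r := by
      rw [Nat.add_sub_cancel]
      linarith
    have hzero := coeff_eq_zero_of_mem_trigPoly hf hdeg
    rw [← sub_zero (coeff _ r), ← hzero,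
      ← coeff_sub h.continuous_sqrt_div (continuous_of_mem_trigPoly hf)]
    exact abs_coeff_le hqa r

theorem abs_coeff_le_exp (h : GappedPair D R x p a b E) (hR : 1 ≤ R) {c : ℝ} (hc : 16 ≤ c)
    (r : Site D) : |coeff (fun k => √(x k / p k)) r| ≤
      c * a / E * Real.exp (-(len r : ℝ) / (c * R * √(a * b) / E)) := by
  have hE := h.gap_pos
  have ha := h.left_pos
  have hN := h.sqrt_mul_pos
  have hR0 : (0 : ℝ) < R := by exact_mod_cast hR
  set n := (len r + R - 1) / (2 * R) with hn
  have hlt : 2 * R * n < len r + R := by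
    have := Nat.mul_div_le (len r + R - 1) (2 * R)
    rw [← hn] at this
    omega
  have hle : (len r : ℝ) ≤ 2 * R * n + R := by
    have := Nat.lt_mul_div_succ (len r + R - 1) (b := 2 * R) (by omega)
    rw [mul_add, ← hn] at this
    exact_mod_cast (by omega : len r ≤ 2 * R * n + R)
  have hexponent : -(rate a b E * n) ≤ 1 + -(len r : ℝ) / (c * R * √(a * b) / E) := by
    have hc16 : (len r : ℝ) / (c * R * √(a * b) / E) ≤ len r / (16 * R * √(a * b) / E) := by
      gcongr
    have hrate : (len r : ℝ) / (16 * R * √(a * b) / E) = rate a b E / 4 * (len r / R) := by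
      rw [rate]; field_simp; norm_num
    have hlen : rate a b E / 4 * (len r / R) ≤ rate a b E / 4 * (2 * n + 1) := by
      gcongr
      · linarith [h.rate_pos]
      · rw [div_le_iff₀ hR0]; linarith
    have := mul_nonneg h.rate_pos.le n.cast_nonneg
    rw [neg_div]
    linarith [h.rate_le_half]
  calc |coeff (fun k => √(x k / p k)) r|
      ≤ 4 * a / E * Real.exp (-(rate a b E * n)) := h.abs_coeff_le_exp_of_lt hlt
    _ ≤ 4 * a / E * Real.exp (1 + -(len r : ℝ) / (c * R * √(a * b) / E)) := by gcongr
    _ = 4 * Real.exp 1 * a / E * Real.exp (-(len r : ℝ) / (c * R * √(a * b) / E)) := by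
        rw [Real.exp_add]; ring
    _ ≤ c * a / E * Real.exp (-(len r : ℝ) / (c * R * √(a * b) / E)) := by
        gcongr
        linarith [Real.exp_one_lt_d9]

end GappedPair

lemma forall_pos_or_forall_neg {α : Type*} [TopologicalSpace α] [PreconnectedSpace α] {f : α → ℝ}
    (hf : Continuous f) (h0 : ∀ x, f x ≠ 0) : (∀ x, 0 < f x) ∨ ∀ x, f x < 0 := by
  by_contra! h
  obtain ⟨⟨x, hx⟩, y, hy⟩ := h
  obtain ⟨z, hz⟩ := mem_range_of_exists_le_of_exists_ge hf ⟨x, hx⟩ ⟨y, hy⟩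
  exact h0 z hz

namespace QBH

lemma symbol_mem_trigPoly {D R : ℕ} {M : Matrix (Site D) (Site D) ℝ}
    (hM : ∀ r, R < len r → M 0 r = 0) : symbol R M ∈ trigPoly D R := by
  have hsum : symbol R M = ∑ r ∈ box D R, M 0 r • fun k => Real.cos (dotK k r) := by
    funext k
    simp [symbol, Finset.sum_apply]
  rw [hsum]
  refine Submodule.sum_mem _ fun r _ => ?_
  by_cases hr : len r ≤ R
  · exact Submodule.smul_mem _ _ (cos_mem_trigPoly hr)
  · rw [hM r (not_le.mp hr), zero_smul]
    exact Submodule.zero_mem _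

lemma abs_symbol_le_opNorm {D R : ℕ} (M : Matrix (Site D) (Site D) ℝ) (k : Momentum D) :
    |symbol R M k| ≤ opNorm R M := by
  refine le_ciSup (f := fun k => |symbol R M k|) ⟨∑ r ∈ box D R, |M 0 r|, ?_⟩ k
  rintro _ ⟨k, rfl⟩
  refine (Finset.abs_sum_le_sum_abs _ _).trans (Finset.sum_le_sum fun r _ => ?_)
  rw [abs_mul]
  exact mul_le_of_le_one_right (abs_nonneg _) (Real.abs_cos_le_one _)

variable {D R : ℕ} (H : QBH D R)

lemma X_mem_trigPoly : H.X ∈ trigPoly D R :=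
  symbol_mem_trigPoly fun r hr => by simp [Hxx, H.K_range r hr, H.Δ_range r hr]

lemma P_mem_trigPoly : H.P ∈ trigPoly D R :=
  symbol_mem_trigPoly fun r hr => by simp [Hpp, H.K_range r hr, H.Δ_range r hr]

lemma abs_X_le (k : Momentum D) : |H.X k| ≤ H.normHxx := abs_symbol_le_opNorm _ k

lemma abs_P_le (k : Momentum D) : |H.P k| ≤ H.normHpp := abs_symbol_le_opNorm _ k

variable {H}

theorem exists_gappedPair (hxp : H.Hxp + H.Hxpᵀ = 0) (hs : H.DynamicallyStable)
    (hgap : 0 < H.kreinGap) : ∃ x p : Momentum D → ℝ,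
      GappedPair D R x p H.normHxx H.normHpp H.kreinGap ∧ ∀ k, x k / p k = H.X k / H.P k := by
  have hpos := X_mul_P_pos hxp hs hgap
  have hle := sq_kreinGap_le hxp hs
  rcases forall_pos_or_forall_neg (continuous_of_mem_trigPoly H.X_mem_trigPoly)
    fun k => left_ne_zero_of_mul (hpos k).ne' with hX | hX
  · have hP k : 0 < H.P k := pos_of_mul_pos_right (hpos k) (hX k).le
    exact ⟨H.X, H.P, ⟨H.X_mem_trigPoly, H.P_mem_trigPoly, hX, hP,
      fun k => (le_abs_self _).trans (H.abs_X_le k),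
      fun k => (le_abs_self _).trans (H.abs_P_le k), hgap, hle⟩, fun _ => rfl⟩
  · have hP k : H.P k < 0 := neg_of_mul_pos_right (hpos k) (hX k).le
    exact ⟨-H.X, -H.P, ⟨Submodule.neg_mem _ H.X_mem_trigPoly, Submodule.neg_mem _ H.P_mem_trigPoly,
      fun k => neg_pos.mpr (hX k), fun k => neg_pos.mpr (hP k),
      fun k => (neg_le_abs _).trans (H.abs_X_le k), fun k => (neg_le_abs _).trans (H.abs_P_le k),
      hgap, fun k => by simpa using hle k⟩, fun k => neg_div_neg_eq _ _⟩

end QBH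

/-! ### Entropy of Gaussian states -/

section Entropy

open Matrix Polynomial

lemma mul_log_succ_sub_log_le {b : ℝ} (hb : 0 ≤ b) :
    b * (Real.log (b + 1) - Real.log b) ≤ 2 * √(b * (b + 1)) := by
  rcases hb.eq_or_lt with rfl | hb
  · simp
  have hlog : Real.log (b + 1) - Real.log b = 2 * Real.log √((b + 1) / b) := by
    rw [Real.log_sqrt (by positivity), Real.log_div (by positivity) hb.ne']
    ring
  have hsqrt : b * √((b + 1) / b) = √(b * (b + 1)) := by
    rw [show b * (b + 1) = b ^ 2 * ((b + 1) / b) by field_simp,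
      Real.sqrt_mul (by positivity), Real.sqrt_sq hb.le]
  have hle := Real.log_le_self (Real.sqrt_nonneg ((b + 1) / b))
  calc b * (Real.log (b + 1) - Real.log b) = 2 * (b * Real.log √((b + 1) / b)) := by
        rw [hlog]; ring
    _ ≤ 2 * (b * √((b + 1) / b)) := by gcongr
    _ = 2 * √(b * (b + 1)) := by rw [hsqrt]

lemma modeEntropy_sqrt_one_add_le {t : ℝ} (ht : 0 ≤ t) :
    modeEntropy √(1 + t) ≤ 3 / 2 * √t := by
  obtain ⟨b, hb⟩ : ∃ b, √(1 + t) = 2 * b + 1 := ⟨(√(1 + t) - 1) / 2, by ring⟩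
  have hb0 : 0 ≤ b := by
    have : 1 ≤ √(1 + t) := Real.one_le_sqrt.mpr (by linarith)
    linarith
  have ht' : √t = 2 * √(b * (b + 1)) := by
    have hsq : (2 * b + 1) ^ 2 = 1 + t := by rw [← hb, Real.sq_sqrt (by linarith)]
    rw [show t = 2 ^ 2 * (b * (b + 1)) by linarith, Real.sqrt_mul (by norm_num),
      Real.sqrt_sq (by norm_num)]
  have hlog : Real.log (b + 1) ≤ b := by
    linarith [Real.log_le_sub_one_of_pos (by linarith : 0 < b + 1)]
  have hsqrt : b ≤ √(b * (b + 1)) := Real.le_sqrt_of_sq_le (by nlinarith)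
  calc modeEntropy √(1 + t) = (b + 1) * Real.log (b + 1) - b * Real.log b := by
        rw [modeEntropy, hb]; ring_nf
    _ = Real.log (b + 1) + b * (Real.log (b + 1) - Real.log b) := by ring
    _ ≤ 3 / 2 * √t := by linarith [mul_log_succ_sub_log_le hb0]

section Matrices

variable {m : Type*} [Fintype m] [DecidableEq m]

lemma charpoly_fromBlocks_antidiagonal {A : Type*} [CommRing A] (M N : Matrix m m A) :
    (fromBlocks 0 M N 0).charpoly = (M * N).charpoly.comp (X ^ 2) := by
  have hcharmatrix : (fromBlocks 0 M N 0).charmatrix =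
      fromBlocks (scalar m (X : A[X])) (-M.map C) (-N.map C) (scalar m X) := by
    rw [charmatrix_fromBlocks]
    simp [charmatrix]
  have hmul : fromBlocks (scalar m (X : A[X])) (-M.map C) (-N.map C) (scalar m X) *
        fromBlocks (scalar m X) 0 (N.map C) 1 =
      fromBlocks (scalar m (X ^ 2) - (M * N).map C) (-M.map C) 0 (scalar m X) := by
    have hcomm := (scalar_commute (X : A[X]) (fun _ => Commute.all _ _) (N.map C)).eq
    rw [fromBlocks_multiply, hcomm, ← map_mul, ← sq, Matrix.map_mul, sub_eq_add_neg]
    simp only [Matrix.neg_mul, Matrix.mul_zero, Matrix.mul_one, zero_add, neg_add_cancel]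
  have hdet : (scalar m (X ^ 2) - (M * N).map C).det = (M * N).charpoly.comp (X ^ 2) := by
    rw [Matrix.charpoly, ← coe_compRingHom_apply, RingHom.map_det]
    congr 1
    ext1 i j
    by_cases hij : i = j <;> simp [hij, -Matrix.map_mul]
  have hregular : IsRegular (scalar m (X : A[X])).det := by
    rw [scalar_apply, det_diagonal, Finset.prod_const]
    exact (monic_X_pow _).isRegular
  have h := congrArg det hmul
  rw [det_mul, det_fromBlocks_zero₁₂, det_fromBlocks_zero₂₁, det_one, mul_one, hdet] at h
  rw [Matrix.charpoly, hcharmatrix]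
  exact hregular.right h

lemma roots_prod_X_sub_C_comp {ι A : Type*} [Fintype ι] [CommRing A] [IsDomain A] (f : ι → A) :
    (∏ i, (X - C (f i))).roots = Finset.univ.val.map f := by
  rw [← roots_multiset_prod_X_sub_C (Finset.univ.val.map f), Multiset.map_map]
  rfl

lemma charpoly_I_smul_symplecticForm_mul_fromBlocks (A B : Matrix m m ℝ) :
    (Complex.I • (symplecticForm m * fromBlocks A 0 0 B).map Complex.ofReal).charpoly =
      ((B * A).charpoly.map Complex.ofRealHom).comp (X ^ 2) := by
  have hblocks : Complex.I • (symplecticForm m * fromBlocks A 0 0 B).map Complex.ofReal =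
      fromBlocks 0 (Complex.I • B.map Complex.ofReal) (-Complex.I • A.map Complex.ofReal) 0 := by
    rw [symplecticForm, fromBlocks_multiply]
    ext (i | i) (j | j) <;> simp
  have hmul : (Complex.I • B.map Complex.ofReal) * (-Complex.I • A.map Complex.ofReal) =
      (B * A).map Complex.ofRealHom := by
    rw [Matrix.smul_mul, Matrix.mul_smul, smul_smul, Matrix.map_mul, mul_neg, Complex.I_mul_I,
      neg_neg, one_smul]
    rfl
  rw [hblocks, charpoly_fromBlocks_antidiagonal, hmul, Matrix.charpoly_map]

lemma symplecticEigenvalues_fromBlocks {A B : Matrix m m ℝ} {t : m → ℝ} (ht : ∀ i, 0 < t i)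
    (h : (B * A).charpoly = ∏ i, (X - C (t i))) :
    symplecticEigenvalues (fromBlocks A 0 0 B) = Finset.univ.val.map fun i => √(t i) := by
  have hcharpoly : (Complex.I • (symplecticForm m * fromBlocks A 0 0 B).map
      Complex.ofReal).charpoly =
        (∏ i, (X - C ((√(t i) : ℝ) : ℂ))) * ∏ i, (X - C ((-√(t i) : ℝ) : ℂ)) := by
    rw [charpoly_I_smul_symplecticForm_mul_fromBlocks, h, Polynomial.map_prod, prod_comp,
      ← Finset.prod_mul_distrib]
    refine Finset.prod_congr rfl fun i _ => ?_
    have hsq : ((t i : ℝ) : ℂ) = (√(t i) : ℝ) * (√(t i) : ℝ) := by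
      rw [← Complex.ofReal_mul, Real.mul_self_sqrt (ht i).le]
    simp only [Polynomial.map_sub, map_X, map_C, sub_comp, X_comp, C_comp,
      Complex.ofRealHom_eq_coe, Complex.ofReal_neg, C_neg]
    rw [hsq, C_mul]
    ring
  rw [symplecticEigenvalues, hcharpoly, roots_mul (mul_ne_zero
    (Finset.prod_ne_zero_iff.mpr fun _ _ => X_sub_C_ne_zero _)
    (Finset.prod_ne_zero_iff.mpr fun _ _ => X_sub_C_ne_zero _)),
    roots_prod_X_sub_C_comp, roots_prod_X_sub_C_comp, Multiset.map_add, Multiset.filter_add,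
    Multiset.map_map, Multiset.map_map, Multiset.filter_eq_self.mpr, Multiset.filter_eq_nil.mpr,
    add_zero]
  · rfl
  · intro x hx
    obtain ⟨i, -, rfl⟩ := Multiset.mem_map.mp hx
    simp
  · intro x hx
    obtain ⟨i, -, rfl⟩ := Multiset.mem_map.mp hx
    simpa using ht i

section Peierls

variable {𝕜 : Type*} [RCLike 𝕜] {M : Matrix m m 𝕜}

lemma re_diag_eq_sum_normSq_mul_eigenvalues (hM : M.IsHermitian) (i : m) :
    RCLike.re (M i i) = ∑ k, ‖hM.eigenvectorUnitary.1 i k‖ ^ 2 * hM.eigenvalues k := by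
  conv_lhs => rw [hM.spectral_theorem, Unitary.conjStarAlgAut_apply, Matrix.mul_apply, map_sum]
  refine Finset.sum_congr rfl fun k _ => ?_
  rw [mul_diagonal, star_apply, Function.comp_apply, mul_right_comm, RCLike.star_def,
    RCLike.mul_conj, ← RCLike.ofReal_pow, ← RCLike.ofReal_mul, RCLike.ofReal_re]

lemma sum_norm_sq_row_of_mem_unitaryGroup {U : Matrix m m 𝕜} (hU : U ∈ unitaryGroup m 𝕜)
    (i : m) : ∑ k, ‖U i k‖ ^ 2 = 1 := by
  have h := congrFun (congrFun (mem_unitaryGroup_iff.mp hU) i) i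
  rw [Matrix.mul_apply, one_apply_eq] at h
  simp only [star_apply, RCLike.star_def, RCLike.mul_conj] at h
  exact_mod_cast h

lemma sum_norm_sq_col_of_mem_unitaryGroup {U : Matrix m m 𝕜} (hU : U ∈ unitaryGroup m 𝕜)
    (k : m) : ∑ i, ‖U i k‖ ^ 2 = 1 := by
  simpa using sum_norm_sq_row_of_mem_unitaryGroup (Unitary.star_mem hU) k

lemma sum_eigenvalues_le_sum_diag_of_concaveOn {s : Set ℝ} {f : ℝ → ℝ} (hf : ConcaveOn ℝ s f)
    (hM : M.IsHermitian) (hs : ∀ i, hM.eigenvalues i ∈ s) :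
    ∑ i, f (hM.eigenvalues i) ≤ ∑ i, f (RCLike.re (M i i)) := by
  have hU := hM.eigenvectorUnitary.2
  calc ∑ k, f (hM.eigenvalues k)
      = ∑ k, ∑ i, ‖hM.eigenvectorUnitary.1 i k‖ ^ 2 * f (hM.eigenvalues k) := by
        simp only [← Finset.sum_mul, sum_norm_sq_col_of_mem_unitaryGroup hU, one_mul]
    _ = ∑ i, ∑ k, ‖hM.eigenvectorUnitary.1 i k‖ ^ 2 * f (hM.eigenvalues k) :=
        Finset.sum_comm
    _ ≤ ∑ i, f (RCLike.re (M i i)) := by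
        refine Finset.sum_le_sum fun i _ => ?_
        rw [re_diag_eq_sum_normSq_mul_eigenvalues hM i]
        exact hf.le_map_sum (fun _ _ => sq_nonneg _)
          (sum_norm_sq_row_of_mem_unitaryGroup hU i) fun k _ => hs k

end Peierls

lemma sum_sqrt_eigenvalues_le {M : Matrix m m ℝ} (hM : M.PosSemidef) :
    ∑ i, √(hM.isHermitian.eigenvalues i) ≤ ∑ i, √(M i i) :=
  sum_eigenvalues_le_sum_diag_of_concaveOn Real.strictConcaveOn_sqrt.concaveOn hM.isHermitian
    hM.eigenvalues_nonneg

open scoped MatrixOrder in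
lemma exists_charpoly_mul_eq_of_posSemidef {S A : Matrix m m ℝ} (hS : S.PosSemidef)
    (hA : A.PosSemidef) {a : ℝ} (ha : 0 ≤ a) (hAa : (a • 1 - A).PosSemidef) :
    ∃ t : m → ℝ, (∀ i, 0 ≤ t i) ∧ (S * A).charpoly = ∏ i, (X - C (t i)) ∧
      ∑ i, √(t i) ≤ √a * ∑ i, √(S i i) := by
  -- `S A` has the characteristic polynomial of `√S A √S ≤ a S`; apply Peierls' inequality to it.
  set Q := CFC.sqrt S
  have hQ : Qᴴ = Q := (nonneg_iff_posSemidef.mp (CFC.sqrt_nonneg S)).isHermitian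
  have hQQ : Q * Q = S := CFC.sqrt_mul_sqrt_self S hS.nonneg
  have hT : (Qᴴ * A * Q).PosSemidef := hA.conjTranspose_mul_mul_same Q
  have hcharpoly : (S * A).charpoly = (Qᴴ * A * Q).charpoly := by
    rw [hQ, charpoly_mul_comm (Q * A), ← Matrix.mul_assoc, hQQ]
  have hdiag : ∀ i, (Qᴴ * A * Q) i i ≤ a * S i i := fun i => by
    have h := (hAa.conjTranspose_mul_mul_same Q).diag_nonneg (i := i)
    have hsub : Qᴴ * (a • 1 - A) * Q = a • S - Qᴴ * A * Q := by
      rw [Matrix.mul_sub, Matrix.sub_mul, Matrix.mul_smul, Matrix.smul_mul, Matrix.mul_one, hQ,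
        hQQ]
    rwa [hsub, Matrix.sub_apply, Matrix.smul_apply, smul_eq_mul, sub_nonneg] at h
  refine ⟨_, hT.eigenvalues_nonneg, hcharpoly.trans hT.isHermitian.charpoly_eq, ?_⟩
  calc ∑ i, √(hT.isHermitian.eigenvalues i) ≤ ∑ i, √((Qᴴ * A * Q) i i) :=
        sum_sqrt_eigenvalues_le hT
    _ ≤ ∑ i, √(a * S i i) := Finset.sum_le_sum fun i _ => Real.sqrt_le_sqrt (hdiag i)
    _ = √a * ∑ i, √(S i i) := by simp only [Real.sqrt_mul ha, Finset.mul_sum]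

variable {A B : Matrix m m ℝ}

lemma posSemidef_sub_inv (hA : A.PosDef) (hAB : (fromBlocks A 1 1 B).PosSemidef) :
    (B - A⁻¹).PosSemidef := by
  have := hA.isUnit.invertible
  have h : (fromBlocks A 1 (1 : Matrix m m ℝ)ᴴ B).PosSemidef := by
    rwa [conjTranspose_one]
  simpa using (PosDef.fromBlocks₁₁ 1 B hA).mp h

lemma sub_inv_diag_le (hA : A.PosDef) (hAB : (fromBlocks A 1 1 B).PosSemidef) (i : m) :
    (B - A⁻¹) i i ≤ (B * A * B - B) i i := by
  have hdet : IsUnit A.det := (isUnit_iff_isUnit_det A).mp hA.isUnit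
  have hS := posSemidef_sub_inv hA hAB
  have hmul : (B - A⁻¹)ᴴ * A * (B - A⁻¹) = B * A * B - B - (B - A⁻¹) := by
    rw [hS.isHermitian.eq, Matrix.sub_mul, nonsing_inv_mul _ hdet, Matrix.sub_mul,
      Matrix.mul_sub, Matrix.mul_assoc B A A⁻¹, mul_nonsing_inv _ hdet, Matrix.mul_one,
      Matrix.one_mul]
  have h := (hA.posSemidef.conjTranspose_mul_mul_same (B - A⁻¹)).diag_nonneg (i := i)
  rwa [hmul, Matrix.sub_apply, sub_nonneg] at h

theorem sum_modeEntropy_fromBlocks_le (hA : A.PosDef) (hAB : (fromBlocks A 1 1 B).PosSemidef)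
    {a : ℝ} (ha : 0 ≤ a) (hAa : (a • 1 - A).PosSemidef) :
    ((symplecticEigenvalues (fromBlocks A 0 0 B)).map modeEntropy).sum ≤
      3 / 2 * (√a * ∑ i, √((B * A * B - B) i i)) := by
  obtain ⟨t, ht, hcharpoly, hsum⟩ :=
    exists_charpoly_mul_eq_of_posSemidef (posSemidef_sub_inv hA hAB) hA.posSemidef ha hAa
  have hBA : (B * A).charpoly = ∏ i, (X - C (1 + t i)) := by
    have hshift : B * A = (B - A⁻¹) * A - scalar m (-1) := by
      rw [Matrix.sub_mul, nonsing_inv_mul _ ((isUnit_iff_isUnit_det A).mp hA.isUnit), map_neg,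
        map_one, sub_neg_eq_add, sub_add_cancel]
    rw [hshift, charpoly_sub_scalar, hcharpoly, prod_comp]
    refine Finset.prod_congr rfl fun i _ => ?_
    simp only [sub_comp, X_comp, C_comp, C_add, C_neg, C_1]
    ring
  rw [symplecticEigenvalues_fromBlocks (fun i => by linarith [ht i]) hBA, Multiset.map_map]
  calc ∑ i, modeEntropy √(1 + t i) ≤ ∑ i, 3 / 2 * √(t i) :=
        Finset.sum_le_sum fun i _ => modeEntropy_sqrt_one_add_le (ht i)
    _ = 3 / 2 * ∑ i, √(t i) := by rw [Finset.mul_sum]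
    _ ≤ 3 / 2 * (√a * ∑ i, √((B - A⁻¹) i i)) := by gcongr
    _ ≤ 3 / 2 * (√a * ∑ i, √((B * A * B - B) i i)) := by
        gcongr with i
        exact sub_inv_diag_le hA hAB i

end Matrices

end Entropy

/-! ### Sums across the boundary of a region -/

section Boundary

variable {D d : ℕ}

lemma exists_len_eq_succ {r : Site D} (hr : r ≠ 0) :
    ∃ s e : Site D, r = s + e ∧ len e = 1 ∧ len r = len s + 1 := by
  obtain ⟨μ, hμ⟩ := Function.ne_iff.mp hr
  rw [Pi.zero_apply] at hμ
  set e : Site D := Pi.single μ (r μ).sign with he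
  have hsign : (r μ).sign.natAbs = 1 := by rw [Int.natAbs_sign, if_neg hμ]
  refine ⟨r - e, e, (sub_add_cancel r e).symm, ?_, ?_⟩
  · rw [len, Finset.sum_eq_single μ (fun ν _ hν => by simp [he, hν]) (by simp), he,
      Pi.single_eq_same, hsign]
  · have hoff : ∀ ν ∈ Finset.univ.erase μ, ((r - e) ν).natAbs = (r ν).natAbs := fun ν hν => by
      simp [he, Finset.ne_of_mem_erase hν]
    have hat : (r μ).natAbs = ((r - e) μ).natAbs + 1 := by
      rw [Pi.sub_apply, he, Pi.single_eq_same]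
      rcases lt_or_gt_of_ne hμ with h | h
      · rw [Int.sign_eq_neg_one_of_neg h]; omega
      · rw [Int.sign_eq_one_of_pos h]; omega
    rw [len, len, ← Finset.add_sum_erase _ _ (Finset.mem_univ μ),
      ← Finset.add_sum_erase _ _ (Finset.mem_univ μ), Finset.sum_congr rfl hoff, hat]
    ring

lemma finite_boundary (B : Finset (Site D)) :
    {q : Site D × Site D | q.1 ∈ B ∧ q.2 ∉ B ∧ len (q.1 - q.2) = 1}.Finite := by
  refine ((B ×ˢ lenBall D 1).finite_toSet.image fun q => (q.1, q.1 - q.2)).subset ?_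
  rintro ⟨i, j⟩ ⟨hi, -, hlen⟩
  refine ⟨(i, i - j), ?_, by simp⟩
  simp only [Finset.coe_product, Set.mem_prod, Finset.mem_coe, mem_lenBall]
  exact ⟨hi, hlen.le⟩

lemma card_filter_add_mem_notMem_le_area (B : Finset (Site D)) (s : Site D) {e : Site D}
    (he : len e = 1) : {i ∈ B | i + s ∈ B ∧ i + (s + e) ∉ B}.card ≤ area B := by
  rw [← Set.ncard_coe_finset, area]
  refine Set.ncard_le_ncard_of_injOn (fun i => (i + s, i + (s + e))) ?_ ?_ (finite_boundary B)
  · intro i hi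
    obtain ⟨-, hs, he'⟩ := Finset.mem_filter.mp (Finset.mem_coe.mp hi)
    refine ⟨hs, he', ?_⟩
    rw [show i + s - (i + (s + e)) = -e by abel, len_neg, he]
  · intro i _ j _ hij
    exact add_right_cancel (Prod.ext_iff.mp hij).1

lemma card_filter_add_notMem_le (B : Finset (Site D)) (r : Site D) :
    {i ∈ B | i + r ∉ B}.card ≤ len r * area B := by
  induction h : len r generalizing r with
  | zero =>
    rw [len_eq_zero.mp h]
    simp
  | succ n ih =>
    obtain ⟨s, e, rfl, he, hlen⟩ := exists_len_eq_succ (r := r) (by rintro rfl; simp at h)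
    have hsub : {i ∈ B | i + (s + e) ∉ B} ⊆
        {i ∈ B | i + s ∉ B} ∪ {i ∈ B | i + s ∈ B ∧ i + (s + e) ∉ B} := by
      intro i hi
      simp only [Finset.mem_union, Finset.mem_filter] at hi ⊢
      tauto
    calc {i ∈ B | i + (s + e) ∉ B}.card
        ≤ {i ∈ B | i + s ∉ B}.card + {i ∈ B | i + s ∈ B ∧ i + (s + e) ∉ B}.card :=
          (Finset.card_le_card hsub).trans (Finset.card_union_le _ _)
      _ ≤ n * area B + area B :=
          add_le_add (ih s (by omega)) (card_filter_add_mem_notMem_le_area B s he)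
      _ = (n + 1) * area B := by ring

lemma card_box (D n : ℕ) : (box D n).card = (2 * n + 1) ^ D := by
  rw [box, Pi.card_Icc]
  simp only [Int.card_Icc, Finset.prod_const, Finset.card_univ, Fintype.card_fin]
  congr 1
  omega

lemma card_filter_len_eq_le (d n N : ℕ) :
    {r ∈ lenBall (d + 1) N | len r = n}.card ≤ 2 * (2 * n + 1) ^ d := by
  have hlen : ∀ r : Site (d + 1), len r = (r 0).natAbs + len (Fin.tail r) := fun r =>
    Fin.sum_univ_succ _
  have hcard : ((Finset.univ : Finset Bool) ×ˢ box d n).card = 2 * (2 * n + 1) ^ d := by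
    rw [Finset.card_product, card_box, Finset.card_univ, Fintype.card_bool]
  -- A site of given length is determined by the sign of its first entry and its other entries.
  rw [← hcard]
  refine Finset.card_le_card_of_injOn (fun r => (decide (0 ≤ r 0), Fin.tail r)) ?_ ?_
  · intro r hr
    have hr := (Finset.mem_filter.mp hr).2
    have htail : len (Fin.tail r) ≤ n := by
      have := hlen r
      omega
    exact Finset.mem_product.mpr ⟨Finset.mem_univ _, mem_box_of_len_le htail⟩
  · intro r hr s hs hrs
    have hr := (Finset.mem_filter.mp hr).2
    have hs := (Finset.mem_filter.mp hs).2
    obtain ⟨hsign, htail⟩ := Prod.ext_iff.mp hrs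
    simp only [decide_eq_decide] at hsign htail
    have hr0 := hlen r
    have hs0 := hlen s
    rw [htail] at hr0
    have h0 : r 0 = s 0 := by omega
    rw [← Fin.cons_self_tail r, ← Fin.cons_self_tail s, h0, htail]

section RadialSums

variable {f : ℕ → ℝ}

lemma exists_sum_sdiff_le_area_mul_sum_lenBall (hf : ∀ n, 0 ≤ f n) (B F : Finset (Site D)) :
    ∃ N, ∑ i ∈ B, ∑ j ∈ F \ B, f (len (i - j)) ≤
      area B * ∑ r ∈ lenBall D N, len r * f (len r) := by
  set N := (B ×ˢ F).sup fun q => len (q.1 - q.2)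
  have hshift : ∀ i ∈ B, ∑ j ∈ F \ B, f (len (i - j)) ≤
      ∑ r ∈ lenBall D N with i + r ∉ B, f (len r) := by
    intro i hi
    have hinj : Set.InjOn (fun j => j - i) (F \ B : Finset (Site D)) :=
      fun j _ k _ h => sub_left_injective h
    calc ∑ j ∈ F \ B, f (len (i - j)) = ∑ r ∈ (F \ B).image (· - i), f (len r) := by
          rw [Finset.sum_image hinj]
          exact Finset.sum_congr rfl fun j _ => by rw [len_sub_comm]
      _ ≤ ∑ r ∈ lenBall D N with i + r ∉ B, f (len r) := by
          refine Finset.sum_le_sum_of_subset_of_nonneg (fun r hr => ?_) fun _ _ _ => hf _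
          obtain ⟨j, hj, rfl⟩ := Finset.mem_image.mp hr
          obtain ⟨hjF, hjB⟩ := Finset.mem_sdiff.mp hj
          rw [Finset.mem_filter, mem_lenBall, add_sub_cancel, len_sub_comm]
          exact ⟨Finset.le_sup (f := fun q : Site D × Site D => len (q.1 - q.2))
            (Finset.mk_mem_product hi hjF), hjB⟩
  refine ⟨N, ?_⟩
  calc ∑ i ∈ B, ∑ j ∈ F \ B, f (len (i - j))
      ≤ ∑ i ∈ B, ∑ r ∈ lenBall D N with i + r ∉ B, f (len r) := Finset.sum_le_sum hshift
    _ = ∑ r ∈ lenBall D N, {i ∈ B | i + r ∉ B}.card * f (len r) := by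
        simp only [Finset.sum_filter]
        rw [Finset.sum_comm]
        simp only [← Finset.sum_filter, Finset.sum_const, nsmul_eq_mul]
    _ ≤ ∑ r ∈ lenBall D N, (len r * area B : ℝ) * f (len r) := by
        gcongr with r
        · exact hf _
        · exact_mod_cast card_filter_add_notMem_le B r
    _ = area B * ∑ r ∈ lenBall D N, len r * f (len r) := by
        rw [Finset.mul_sum]
        exact Finset.sum_congr rfl fun r _ => by ring

lemma sum_lenBall_len_mul_le (hf : ∀ n, 0 ≤ f n) (N : ℕ) :
    ∑ r ∈ lenBall (d + 1) N, len r * f (len r) ≤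
      2 * 3 ^ d * ∑ n ∈ Finset.range N, ((n : ℝ) + 1) ^ (d + 1) * f (n + 1) := by
  have hfiber : ∑ r ∈ lenBall (d + 1) N, (len r : ℝ) * f (len r) =
      ∑ n ∈ Finset.range (N + 1), {r ∈ lenBall (d + 1) N | len r = n}.card * (n * f n) := by
    rw [← Finset.sum_fiberwise_of_maps_to (g := len) (t := Finset.range (N + 1))
      fun r hr => Finset.mem_range.mpr (Nat.lt_succ_of_le (mem_lenBall.mp hr))]
    refine Finset.sum_congr rfl fun n _ => ?_
    rw [← nsmul_eq_mul, ← Finset.sum_const]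
    exact Finset.sum_congr rfl fun r hr => by rw [(Finset.mem_filter.mp hr).2]
  rw [hfiber, Finset.sum_range_succ', Nat.cast_zero, zero_mul, mul_zero, add_zero,
    Finset.mul_sum]
  refine Finset.sum_le_sum fun n _ => ?_
  have hcard : ({r ∈ lenBall (d + 1) N | len r = n + 1}.card : ℝ) ≤
      2 * (3 * ((n : ℝ) + 1)) ^ d := by
    have h := (card_filter_len_eq_le d (n + 1) N).trans
      (Nat.mul_le_mul_left 2 (Nat.pow_le_pow_left (by omega : _ ≤ 3 * (n + 1)) d))
    exact_mod_cast h
  push_cast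
  calc ({r ∈ lenBall (d + 1) N | len r = n + 1}.card : ℝ) * (((n : ℝ) + 1) * f (n + 1))
      ≤ 2 * (3 * ((n : ℝ) + 1)) ^ d * (((n : ℝ) + 1) * f (n + 1)) := by
        gcongr
        exact mul_nonneg (by positivity) (hf _)
    _ = 2 * 3 ^ d * (((n : ℝ) + 1) ^ (d + 1) * f (n + 1)) := by
        rw [mul_pow]; ring

end RadialSums

section ExponentialSums

variable {w : ℝ}

lemma polylog_one_sub_two_mul_succ (d : ℕ) (w : ℝ) : polylog (1 - 2 * ((d + 1 : ℕ) : ℤ)) w =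
    ∑' n : ℕ, ((n : ℝ) + 1) ^ (2 * d + 1) * w ^ (n + 1) := by
  refine tsum_congr fun n => ?_
  rw [show (1 - 2 * ((d + 1 : ℕ) : ℤ)) = -((2 * d + 1 : ℕ) : ℤ) by push_cast; ring, zpow_neg,
    zpow_natCast, div_inv_eq_mul, mul_comm]

lemma summable_succ_pow_mul_pow_succ (k : ℕ) (h0 : 0 ≤ w) (h1 : w < 1) :
    Summable fun n : ℕ => ((n : ℝ) + 1) ^ k * w ^ (n + 1) := by
  have h := summable_pow_mul_geometric_of_norm_lt_one k (r := w)
    (by rwa [Real.norm_eq_abs, abs_of_nonneg h0])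
  exact_mod_cast (summable_nat_add_iff 1).mpr h

lemma polylog_nonneg {s : ℤ} (h0 : 0 ≤ w) : 0 ≤ polylog s w :=
  tsum_nonneg fun n => by positivity

lemma sum_sdiff_pow_len_le (B F : Finset (Site (d + 1))) (h0 : 0 ≤ w) (h1 : w < 1) :
    ∑ i ∈ B, ∑ j ∈ F \ B, w ^ len (i - j) ≤
      2 * 3 ^ d * area B * polylog (1 - 2 * ((d + 1 : ℕ) : ℤ)) w := by
  obtain ⟨N, hN⟩ := exists_sum_sdiff_le_area_mul_sum_lenBall (fun n => pow_nonneg h0 n) B F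
  have hone : ∀ n : ℕ, (1 : ℝ) ≤ n + 1 := fun n => by simp
  calc ∑ i ∈ B, ∑ j ∈ F \ B, w ^ len (i - j)
      ≤ area B * (2 * 3 ^ d * ∑ n ∈ Finset.range N, ((n : ℝ) + 1) ^ (d + 1) * w ^ (n + 1)) :=
        hN.trans <| mul_le_mul_of_nonneg_left
          (sum_lenBall_len_mul_le (fun n => pow_nonneg h0 n) N) (Nat.cast_nonneg _)
    _ ≤ area B * (2 * 3 ^ d *
          ∑ n ∈ Finset.range N, ((n : ℝ) + 1) ^ (2 * d + 1) * w ^ (n + 1)) := by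
        gcongr with n
        · exact hone n
        · omega
    _ ≤ area B * (2 * 3 ^ d * polylog (1 - 2 * ((d + 1 : ℕ) : ℤ)) w) := by
        rw [polylog_one_sub_two_mul_succ]
        gcongr
        exact (summable_succ_pow_mul_pow_succ _ h0 h1).sum_le_tsum _ fun n _ => by positivity
    _ = 2 * 3 ^ d * area B * polylog (1 - 2 * ((d + 1 : ℕ) : ℤ)) w := by ring

lemma sum_sum_compl_pow_len_le (B : Finset (Site (d + 1))) (h0 : 0 ≤ w) (h1 : w < 1)
    (F : Finset {j // j ∉ B}) :
    ∑ i ∈ B, ∑ j ∈ F, w ^ len (i - j.1) ≤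
      2 * 3 ^ d * area B * polylog (1 - 2 * ((d + 1 : ℕ) : ℤ)) w := by
  have hF : F.map (Function.Embedding.subtype _) \ B = F.map (Function.Embedding.subtype _) :=
    Finset.sdiff_eq_self_of_disjoint <| Finset.disjoint_left.mpr fun j hj => by
      obtain ⟨j, -, rfl⟩ := Finset.mem_map.mp hj
      exact j.2
  have h := sum_sdiff_pow_len_le B (F.map (Function.Embedding.subtype _)) h0 h1
  simpa only [hF, Finset.sum_map, Function.Embedding.subtype_apply] using h

lemma summable_compl_pow_len {B : Finset (Site (d + 1))} (h0 : 0 ≤ w) (h1 : w < 1)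
    {i : Site (d + 1)} (hi : i ∈ B) :
    Summable fun j : {j // j ∉ B} => w ^ len (i - j.1) :=
  summable_of_sum_le (fun _ => pow_nonneg h0 _) fun F =>
    (Finset.single_le_sum (f := fun i => ∑ j ∈ F, w ^ len (i - j.1))
      (fun _ _ => Finset.sum_nonneg fun _ _ => pow_nonneg h0 _) hi).trans
        (sum_sum_compl_pow_len_le B h0 h1 F)

theorem sum_tsum_compl_pow_len_le (B : Finset (Site (d + 1))) (h0 : 0 ≤ w) (h1 : w < 1) :
    ∑ i ∈ B, ∑' j : {j // j ∉ B}, w ^ len (i - j.1) ≤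
      2 * 3 ^ d * area B * polylog (1 - 2 * ((d + 1 : ℕ) : ℤ)) w := by
  rw [← Summable.tsum_finsetSum fun i hi => summable_compl_pow_len h0 h1 hi]
  refine Summable.tsum_le_of_sum_le (summable_sum fun i hi => summable_compl_pow_len h0 h1 hi)
    fun F => ?_
  rw [Finset.sum_comm]
  exact sum_sum_compl_pow_len_le B h0 h1 F

end ExponentialSums

end Boundary

/-! ### The area law -/

section CoeffMatrix

open MeasureTheory Matrix

variable {D : ℕ} {B : Finset (Site D)} {f u v : Momentum D → ℝ}

/-- The real part of the trigonometric polynomial with coefficients `y` on the region `B`. -/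
def cosSum (y : B → ℝ) (k : Momentum D) : ℝ := ∑ i, y i * Real.cos (dotK k i)

/-- The imaginary part of the trigonometric polynomial with coefficients `y` on the region `B`. -/
def sinSum (y : B → ℝ) (k : Momentum D) : ℝ := ∑ i, y i * Real.sin (dotK k i)

@[fun_prop] lemma continuous_cosSum (y : B → ℝ) : Continuous (cosSum y) := by
  unfold cosSum; fun_prop

@[fun_prop] lemma continuous_sinSum (y : B → ℝ) : Continuous (sinSum y) := by
  unfold sinSum; fun_prop

@[simp] lemma cosSum_single (i : B) (k : Momentum D) :
    cosSum (Pi.single i 1) k = Real.cos (dotK k i) := by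
  simp [cosSum, Pi.single_apply]

@[simp] lemma sinSum_single (i : B) (k : Momentum D) :
    sinSum (Pi.single i 1) k = Real.sin (dotK k i) := by
  simp [sinSum, Pi.single_apply]

/-- The compression to `B` of the translationally invariant lattice operator with symbol `f`. -/
def coeffMatrix (f : Momentum D → ℝ) (B : Finset (Site D)) : Matrix B B ℝ :=
  .of fun i j => coeff f (i.1 - j.1)

lemma coeffMatrix_comm (f : Momentum D → ℝ) (i j : B) :
    coeffMatrix f B i j = coeffMatrix f B j i := coeff_sub_comm f i.1 j.1

lemma isHermitian_coeffMatrix (f : Momentum D → ℝ) : (coeffMatrix f B).IsHermitian :=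
  IsHermitian.ext fun i j => coeffMatrix_comm f j i

lemma coeffMatrix_one : coeffMatrix (fun _ => 1) B = 1 := by
  ext i j
  simp only [coeffMatrix, of_apply, coeff, mul_one, integral_cos_dotK, sub_eq_zero, one_apply,
    Subtype.ext_iff]

lemma dotProduct_coeffMatrix_mulVec (hf : Continuous f) (y z : B → ℝ) :
    y ⬝ᵥ coeffMatrix f B *ᵥ z =
      ∫ k, f k * (cosSum y k * cosSum z k + sinSum y k * sinSum z k) ∂bzMeasure D := by
  have hexpand (k : Momentum D) : f k * (cosSum y k * cosSum z k + sinSum y k * sinSum z k) =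
      ∑ i, ∑ j, y i * z j * (Real.cos (dotK k (i.1 - j.1)) * f k) := by
    simp only [cosSum, sinSum, Finset.sum_mul_sum, dotK_sub, Real.cos_sub]
    simp only [← Finset.sum_add_distrib, Finset.mul_sum]
    exact Finset.sum_congr rfl fun i _ => Finset.sum_congr rfl fun j _ => by ring
  simp only [hexpand]
  rw [integral_finsetSum _ fun i _ => integrable_bzMeasure (by fun_prop)]
  simp only [dotProduct, mulVec, Finset.mul_sum]
  refine Finset.sum_congr rfl fun i _ => ?_
  rw [integral_finsetSum _ fun j _ => integrable_bzMeasure (by fun_prop)]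
  refine Finset.sum_congr rfl fun j _ => ?_
  rw [integral_const_mul, coeffMatrix, of_apply, coeff]
  ring

lemma dotProduct_eq_integral (y z : B → ℝ) :
    y ⬝ᵥ z = ∫ k, cosSum y k * cosSum z k + sinSum y k * sinSum z k ∂bzMeasure D := by
  simpa only [coeffMatrix_one, one_mulVec, one_mul] using
    dotProduct_coeffMatrix_mulVec (f := fun _ => 1) continuous_const y z

lemma posSemidef_coeffMatrix (hf : Continuous f) (hf0 : ∀ k, 0 ≤ f k) :
    (coeffMatrix f B).PosSemidef := by
  refine .of_dotProduct_mulVec_nonneg (isHermitian_coeffMatrix f) fun y => ?_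
  rw [star_trivial, dotProduct_coeffMatrix_mulVec hf]
  exact integral_nonneg fun k =>
    mul_nonneg (hf0 k) (add_nonneg (mul_self_nonneg _) (mul_self_nonneg _))

lemma coeffMatrix_const (c : ℝ) : coeffMatrix (fun _ => c) B = c • 1 := by
  rw [← coeffMatrix_one]
  ext i j
  simp only [coeffMatrix, coeff, of_apply, Matrix.smul_apply, smul_eq_mul, mul_one,
    integral_mul_const, mul_comm c]

lemma coeffMatrix_sub (hu : Continuous u) (hv : Continuous v) :
    coeffMatrix (fun k => u k - v k) B = coeffMatrix u B - coeffMatrix v B :=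
  Matrix.ext fun _ _ => coeff_sub hu hv _

lemma posSemidef_smul_one_sub_coeffMatrix (hf : Continuous f) {α : ℝ} (h : ∀ k, f k ≤ α) :
    (α • 1 - coeffMatrix f B).PosSemidef := by
  rw [← coeffMatrix_const, ← coeffMatrix_sub continuous_const hf]
  exact posSemidef_coeffMatrix (by fun_prop) fun k => sub_nonneg.mpr (h k)

lemma posDef_coeffMatrix (hf : Continuous f) {β : ℝ} (hβ : 0 < β) (h : ∀ k, β ≤ f k) :
    (coeffMatrix f B).PosDef := by
  have hsub : (coeffMatrix f B - β • 1).PosSemidef := by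
    rw [← coeffMatrix_const, ← coeffMatrix_sub hf continuous_const]
    exact posSemidef_coeffMatrix (by fun_prop) fun k => sub_nonneg.mpr (h k)
  rw [← sub_add_cancel (coeffMatrix f B) (β • 1)]
  exact PosDef.posSemidef_add hsub (PosDef.one.smul hβ)

lemma posSemidef_fromBlocks_coeffMatrix (hu : Continuous u) (hv : Continuous v)
    (hu0 : ∀ k, 0 ≤ u k) (huv : ∀ k, u k * v k = 1) :
    (fromBlocks (coeffMatrix u B) 1 1 (coeffMatrix v B)).PosSemidef := by
  refine .of_dotProduct_mulVec_nonneg (isHermitian_fromBlocks_iff.mpr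
    ⟨isHermitian_coeffMatrix u, conjTranspose_one, conjTranspose_one,
      isHermitian_coeffMatrix v⟩) fun y => ?_
  obtain ⟨y, z, rfl⟩ : ∃ y₁ y₂ : B → ℝ, y = Sum.elim y₁ y₂ :=
    ⟨y ∘ Sum.inl, y ∘ Sum.inr, (Sum.elim_comp_inl_inr y).symm⟩
  have hform : Sum.elim y z ⬝ᵥ fromBlocks (coeffMatrix u B) 1 1 (coeffMatrix v B) *ᵥ
      Sum.elim y z = y ⬝ᵥ coeffMatrix u B *ᵥ y + 2 * (y ⬝ᵥ z) + z ⬝ᵥ coeffMatrix v B *ᵥ z := by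
    rw [fromBlocks_mulVec, sumElim_dotProduct_sumElim]
    simp only [Sum.elim_comp_inl, Sum.elim_comp_inr, one_mulVec, dotProduct_add]
    rw [dotProduct_comm z y]
    ring
  have hsquare (k : Momentum D) :
      u k * (cosSum y k * cosSum y k + sinSum y k * sinSum y k) +
        2 * (cosSum y k * cosSum z k + sinSum y k * sinSum z k) +
        v k * (cosSum z k * cosSum z k + sinSum z k * sinSum z k) =
      u k * ((cosSum y k + v k * cosSum z k) ^ 2 + (sinSum y k + v k * sinSum z k) ^ 2) := by
    linear_combination (-2 * (cosSum y k * cosSum z k + sinSum y k * sinSum z k) -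
      v k * (cosSum z k * cosSum z k + sinSum z k * sinSum z k)) * huv k
  rw [star_trivial, hform, dotProduct_coeffMatrix_mulVec hu, dotProduct_coeffMatrix_mulVec hv,
    dotProduct_eq_integral, ← integral_const_mul,
    ← integral_add (integrable_bzMeasure (by fun_prop)) (integrable_bzMeasure (by fun_prop)),
    ← integral_add (integrable_bzMeasure (by fun_prop)) (integrable_bzMeasure (by fun_prop))]
  refine integral_nonneg fun k => ?_
  simp only [hsquare]
  exact mul_nonneg (hu0 k) (by positivity)

/-- The squared modulus of the error made at momentum `k` when the column of the operator with
symbol `v` at the site `i` is replaced by its restriction to `B`. -/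
def truncationError (v : Momentum D → ℝ) (i : B) (k : Momentum D) : ℝ :=
  (v k * Real.cos (dotK k i) - cosSum (coeffMatrix v B i) k) ^ 2 +
    (v k * Real.sin (dotK k i) - sinSum (coeffMatrix v B i) k) ^ 2

lemma truncationError_nonneg (v : Momentum D → ℝ) (i : B) (k : Momentum D) :
    0 ≤ truncationError v i k := by
  unfold truncationError; positivity

lemma continuous_truncationError (hv : Continuous v) (i : B) :
    Continuous (truncationError v i) := by
  unfold truncationError; fun_prop

lemma coeffMatrix_mulVec_single (v : Momentum D → ℝ) (i : B) :
    coeffMatrix v B *ᵥ Pi.single i 1 = coeffMatrix v B i := by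
  rw [mulVec_single_one]
  exact funext fun j => coeffMatrix_comm v j i

lemma integral_truncationError (hv : Continuous v) (i : B) :
    ∫ k, truncationError v i k ∂bzMeasure D =
      ∫ k, v k ^ 2 ∂bzMeasure D - ∑ l ∈ B, coeff v (i - l) ^ 2 := by
  set y : B → ℝ := coeffMatrix v B i
  set e : B → ℝ := Pi.single i 1 with he
  have hexpand (k : Momentum D) : truncationError v i k =
      v k ^ 2 - 2 * (v k * (cosSum y k * cosSum e k + sinSum y k * sinSum e k)) +
        (cosSum y k * cosSum y k + sinSum y k * sinSum y k) := by
    rw [truncationError, he, cosSum_single, sinSum_single]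
    linear_combination v k ^ 2 * Real.sin_sq_add_cos_sq (dotK k i)
  have hnorm : y ⬝ᵥ y = ∑ l ∈ B, coeff v (i - l) ^ 2 := by
    rw [← Finset.sum_coe_sort B fun l => coeff v (i - l) ^ 2]
    exact Finset.sum_congr rfl fun l _ => (sq _).symm
  simp only [hexpand]
  rw [integral_add (integrable_bzMeasure (by fun_prop)) (integrable_bzMeasure (by fun_prop)),
    integral_sub (integrable_bzMeasure (by fun_prop)) (integrable_bzMeasure (by fun_prop)),
    integral_const_mul, ← dotProduct_coeffMatrix_mulVec hv, ← dotProduct_eq_integral, he,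
    coeffMatrix_mulVec_single, hnorm]
  ring

lemma integral_mul_truncationError (hu : Continuous u) (hv : Continuous v)
    (huv : ∀ k, u k * v k = 1) (i : B) :
    ∫ k, u k * truncationError v i k ∂bzMeasure D =
      (coeffMatrix v B * coeffMatrix u B * coeffMatrix v B - coeffMatrix v B) i i := by
  set y : B → ℝ := coeffMatrix v B i
  set e : B → ℝ := Pi.single i 1 with he
  have hexpand (k : Momentum D) : u k * truncationError v i k =
      v k * (cosSum e k * cosSum e k + sinSum e k * sinSum e k) -
        2 * (cosSum e k * cosSum y k + sinSum e k * sinSum y k) +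
        u k * (cosSum y k * cosSum y k + sinSum y k * sinSum y k) := by
    rw [truncationError, he, cosSum_single, sinSum_single]
    linear_combination (v k * (Real.cos (dotK k i) ^ 2 + Real.sin (dotK k i) ^ 2) -
      2 * (Real.cos (dotK k i) * cosSum y k + Real.sin (dotK k i) * sinSum y k)) * huv k
  have hform : (coeffMatrix v B * coeffMatrix u B * coeffMatrix v B) i i =
      y ⬝ᵥ coeffMatrix u B *ᵥ y := by
    rw [Matrix.mul_assoc, mul_apply]
    refine Finset.sum_congr rfl fun l _ => congrArg _ ?_
    rw [mul_apply]
    exact Finset.sum_congr rfl fun m _ => congrArg _ (coeffMatrix_comm v m i)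
  simp only [hexpand]
  rw [integral_add (integrable_bzMeasure (by fun_prop)) (integrable_bzMeasure (by fun_prop)),
    integral_sub (integrable_bzMeasure (by fun_prop)) (integrable_bzMeasure (by fun_prop)),
    integral_const_mul, ← dotProduct_coeffMatrix_mulVec hv, ← dotProduct_coeffMatrix_mulVec hu,
    ← dotProduct_eq_integral, he, coeffMatrix_mulVec_single, single_one_dotProduct,
    Matrix.sub_apply, hform]
  ring

lemma coeffMatrix_mul_mul_sub_le (hu : Continuous u) (hv : Continuous v) {α : ℝ}
    (hα : ∀ k, u k ≤ α) (huv : ∀ k, u k * v k = 1) (i : B) :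
    (coeffMatrix v B * coeffMatrix u B * coeffMatrix v B - coeffMatrix v B) i i ≤
      α * (∫ k, v k ^ 2 ∂bzMeasure D - ∑ l ∈ B, coeff v (i - l) ^ 2) := by
  have hq := continuous_truncationError hv i
  rw [← integral_mul_truncationError hu hv huv, ← integral_truncationError hv,
    ← integral_const_mul]
  exact integral_mono (integrable_bzMeasure (by fun_prop)) (integrable_bzMeasure (by fun_prop))
    fun k => mul_le_mul_of_nonneg_right (hα k) (truncationError_nonneg v i k)

lemma integral_sq_sub_sum_sq_coeff_le (hv : Continuous v)
    (happrox : ∀ ε > 0, ∃ N, ∃ f ∈ trigPoly D N, ∀ k, |v k - f k| ≤ ε) (B : Finset (Site D))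
    {i : Site D} (hsum : Summable fun j : {j // j ∉ B} => |coeff v (i - j)|) :
    ∫ k, v k ^ 2 ∂bzMeasure D - ∑ l ∈ B, coeff v (i - l) ^ 2 ≤
      (∑' j : {j // j ∉ B}, |coeff v (i - j)|) ^ 2 := by
  rw [sub_le_iff_le_add]
  refine integral_sq_le_of_forall_sum_sq_coeff_le hv happrox fun F => ?_
  set G := F.image (i - ·) with hG
  have hshift : ∑ r ∈ F, coeff v r ^ 2 = ∑ j ∈ G, coeff v (i - j) ^ 2 := by
    rw [hG, Finset.sum_image fun r _ s _ h => sub_right_injective h]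
    simp only [sub_sub_cancel]
  have hout : ∑ j ∈ G with j ∉ B, |coeff v (i - j)| ≤ ∑' j : {j // j ∉ B}, |coeff v (i - j)| := by
    rw [← Finset.sum_subtype_eq_sum_filter]
    exact hsum.sum_le_tsum _ fun _ _ => abs_nonneg _
  calc ∑ r ∈ F, coeff v r ^ 2
      = ∑ j ∈ G with j ∉ B, |coeff v (i - j)| ^ 2 + ∑ j ∈ G with j ∈ B, coeff v (i - j) ^ 2 := by
        simp only [sq_abs]
        rw [hshift, add_comm, Finset.sum_filter_add_sum_filter_not]
    _ ≤ (∑ j ∈ G with j ∉ B, |coeff v (i - j)|) ^ 2 + ∑ l ∈ B, coeff v (i - l) ^ 2 := by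
        refine add_le_add (Finset.sum_sq_le_sq_sum_of_nonneg fun _ _ => abs_nonneg _) ?_
        exact Finset.sum_le_sum_of_subset_of_nonneg (fun j hj => (Finset.mem_filter.mp hj).2)
          fun _ _ _ => sq_nonneg _
    _ ≤ _ := by
        gcongr

theorem sum_modeEntropy_coeffMatrix_le (hu : Continuous u) (hv : Continuous v)
    (huv : ∀ k, u k * v k = 1) {α β : ℝ} (hα : ∀ k, u k ≤ α) (hβ : 0 < β) (hβu : ∀ k, β ≤ u k)
    (happrox : ∀ ε > 0, ∃ N, ∃ f ∈ trigPoly D N, ∀ k, |v k - f k| ≤ ε)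
    (hsum : ∀ i ∈ B, Summable fun j : {j // j ∉ B} => |coeff v (i - j)|) :
    ((symplecticEigenvalues
      (fromBlocks (coeffMatrix u B) 0 0 (coeffMatrix v B))).map modeEntropy).sum ≤
      3 / 2 * (α * ∑ i ∈ B, ∑' j : {j // j ∉ B}, |coeff v (i - j)|) := by
  have hu0 (k : Momentum D) : 0 ≤ u k := hβ.le.trans (hβu k)
  have hα0 : 0 ≤ α := (hu0 0).trans (hα 0)
  have hdiag (i : B) :
      √((coeffMatrix v B * coeffMatrix u B * coeffMatrix v B - coeffMatrix v B) i i) ≤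
        √α * ∑' j : {j // j ∉ B}, |coeff v (i - j)| := by
    refine Real.sqrt_le_iff.mpr ⟨by positivity, ?_⟩
    rw [mul_pow, Real.sq_sqrt hα0]
    exact (coeffMatrix_mul_mul_sub_le hu hv hα huv i).trans <|
      mul_le_mul_of_nonneg_left (integral_sq_sub_sum_sq_coeff_le hv happrox B (hsum i i.2)) hα0
  calc _ ≤ 3 / 2 * (√α * ∑ i,
        √((coeffMatrix v B * coeffMatrix u B * coeffMatrix v B - coeffMatrix v B) i i)) :=
        sum_modeEntropy_fromBlocks_le (posDef_coeffMatrix hu hβ hβu)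
          (posSemidef_fromBlocks_coeffMatrix hu hv hu0 huv) hα0
          (posSemidef_smul_one_sub_coeffMatrix hu hα)
    _ ≤ 3 / 2 * (√α * ∑ i : B, √α * ∑' j : {j // j ∉ B}, |coeff v (i - j)|) := by
        gcongr with i
        exact hdiag i
    _ = _ := by
        rw [← Finset.mul_sum, ← mul_assoc √α, Real.mul_self_sqrt hα0,
          Finset.sum_coe_sort B fun i => ∑' j : {j // j ∉ B}, |coeff v (i - j)|]

end CoeffMatrix

namespace GappedPair

variable {D d R : ℕ} {x p : Momentum D → ℝ} {a b E : ℝ}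

lemma sqrt_div_mul_sqrt_div (h : GappedPair D R x p a b E) (k : Momentum D) :
    √(p k / x k) * √(x k / p k) = 1 := by
  have hx := h.pos_left k
  have hp := h.pos_right k
  rw [← Real.sqrt_mul (by positivity), div_mul_div_cancel₀ hx.ne', div_self hp.ne',
    Real.sqrt_one]

lemma le_sqrt_div (h : GappedPair D R x p a b E) (k : Momentum D) :
    E / (2 * a) ≤ √(p k / x k) := by
  have := h.left_pos
  have := h.gap_pos
  have hx := h.pos_left k
  have hp := h.pos_right k
  rw [← inv_div (2 * a), ← inv_div (x k), Real.sqrt_inv]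
  exact inv_anti₀ (by positivity) (h.sqrt_div_le k)

theorem sum_modeEntropy_le {x p : Momentum (d + 1) → ℝ} (h : GappedPair (d + 1) R x p a b E)
    (B : Finset (Site (d + 1))) {κ w : ℝ} (hw0 : 0 ≤ w) (hw1 : w < 1)
    (hκ : ∀ r, |coeff (fun k => √(x k / p k)) r| ≤ κ * w ^ len r) :
    ((symplecticEigenvalues (Matrix.fromBlocks (coeffMatrix (fun k => √(p k / x k)) B) 0 0
      (coeffMatrix (fun k => √(x k / p k)) B))).map modeEntropy).sum ≤
      3 / 2 * (2 * b / E * (κ * (2 * 3 ^ d * area B *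
        polylog (1 - 2 * ((d + 1 : ℕ) : ℤ)) w))) := by
  have := h.left_pos
  have hb := h.symm.left_pos
  have := h.gap_pos
  have hκ0 : 0 ≤ κ := by simpa using (abs_nonneg _).trans (hκ 0)
  have hdom (i : Site (d + 1)) (hi : i ∈ B) :
      Summable fun j : {j // j ∉ B} => κ * w ^ len (i - j.1) :=
    (summable_compl_pow_len hw0 hw1 hi).mul_left κ
  have hsum (i : Site (d + 1)) (hi : i ∈ B) :
      Summable fun j : {j // j ∉ B} => |coeff (fun k => √(x k / p k)) (i - j)| :=
    (hdom i hi).of_nonneg_of_le (fun _ => abs_nonneg _) fun _ => hκ _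
  refine (sum_modeEntropy_coeffMatrix_le h.symm.continuous_sqrt_div h.continuous_sqrt_div
    h.sqrt_div_mul_sqrt_div h.symm.sqrt_div_le (by positivity) h.le_sqrt_div
    (fun ε hε => h.exists_mem_trigPoly_approx hε) hsum).trans ?_
  gcongr
  calc ∑ i ∈ B, ∑' j : {j // j ∉ B}, |coeff (fun k => √(x k / p k)) (i - j)|
      ≤ ∑ i ∈ B, ∑' j : {j // j ∉ B}, κ * w ^ len (i - j.1) :=
        Finset.sum_le_sum fun i hi => (hsum i hi).tsum_le_tsum (fun _ => hκ _) (hdom i hi)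
    _ = κ * ∑ i ∈ B, ∑' j : {j // j ∉ B}, w ^ len (i - j.1) := by
        simp only [tsum_mul_left, Finset.mul_sum]
    _ ≤ _ := mul_le_mul_of_nonneg_left (sum_tsum_compl_pow_len_le B hw0 hw1) hκ0

end GappedPair

section Covariance

variable {D : ℕ}

lemma fourierBlock_zero : fourierBlock (fun _ : Momentum D => (0 : ℂ)) = 0 := by
  ext j j'
  simp [fourierBlock]

lemma GappedPair.harmonicΓ_eq {R : ℕ} {x p V : Momentum D → ℝ} {a b E : ℝ}
    (h : GappedPair D R x p a b E) (hV : ∀ k, x k / p k = V k) :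
    harmonicΓ V = Matrix.fromBlocks
      (.of fun j j' => coeff (fun k => √(p k / x k)) (j - j')) 0 0
      (.of fun j j' => coeff (fun k => √(x k / p k)) (j - j')) := by
  have hpos (k : Momentum D) : 0 ≤ x k / p k := (div_pos (h.pos_left k) (h.pos_right k)).le
  have hsqrt (k : Momentum D) : V k ^ (1 / 2 : ℝ) = √(x k / p k) := by
    rw [← hV, Real.sqrt_eq_rpow]
  have hinv (k : Momentum D) : V k ^ (-(1 / 2) : ℝ) = √(p k / x k) := by
    rw [Real.rpow_neg (hV k ▸ hpos k), hsqrt, ← Real.sqrt_inv, inv_div]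
  have hblock {f : Momentum D → ℝ} (hf : Continuous f) :
      fourierBlock (fun k => (f k : ℂ)) = .of fun j j' => coeff f (j - j') :=
    Matrix.ext fun j j' => fourierBlock_ofReal hf j j'
  simp only [harmonicΓ, realSpaceCov, Matrix.of_apply, Matrix.cons_val', Matrix.cons_val_zero,
    Matrix.cons_val_one, Matrix.cons_val_fin_one, fourierBlock_zero, hsqrt, hinv,
    hblock h.continuous_sqrt_div, hblock h.symm.continuous_sqrt_div]

lemma restrict_fromBlocks_coeff (u v : Momentum D → ℝ) (B : Finset (Site D)) :
    restrict (Matrix.fromBlocks (.of fun j j' => coeff u (j - j')) 0 0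
      (.of fun j j' => coeff v (j - j'))) B =
      Matrix.fromBlocks (coeffMatrix u B) 0 0 (coeffMatrix v B) := by
  ext (i | i) (j | j) <;> rfl

end Covariance

namespace QBH.Bogoliubov

lemma isCorrelationLength {D R : ℕ} {H : QBH D R} {c : ℝ} (hR : 1 ≤ R) (hc : 16 ≤ c)
    (hs : H.DynamicallyStable) (hgap : 0 < H.kreinGap) (hxp : H.Hxp + H.Hxpᵀ = 0)
    (Q : H.Bogoliubov) :
    IsCorrelationLength Q c (c * R * √(H.normHxx * H.normHpp) / H.kreinGap) := by
  obtain ⟨x, p, h, hV⟩ := QBH.exists_gappedPair hxp hs hgap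
  have hxx := h.left_pos
  have hpp := h.symm.left_pos
  rw [IsCorrelationLength, Q.Γ_eq_harmonicΓ hxp (QBH.X_mul_P_pos hxp hs hgap),
    h.harmonicΓ_eq hV]
  refine ⟨by positivity, fun j j' => ⟨?_, h.abs_coeff_le_exp hR hc _⟩⟩
  rw [mul_comm H.normHxx]
  exact h.symm.abs_coeff_le_exp hR hc _

theorem entanglementEntropy_le {d R : ℕ} {H : QBH (d + 1) R} {c ξ : ℝ} (hc : 3 ^ d ≤ c)
    (hs : H.DynamicallyStable) (hgap : 0 < H.kreinGap) (hxp : H.Hxp + H.Hxpᵀ = 0)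
    (Q : H.Bogoliubov) (hξ : IsCorrelationLength Q c ξ) (B : Finset (Site (d + 1))) :
    entanglementEntropy Q.Γ B ≤
      16 * c ^ 2 * (H.normHxx * H.normHpp) * polylog (1 - 2 * ((d + 1 : ℕ) : ℤ))
        (Real.exp (-1 / ξ)) * area B / H.kreinGap ^ 2 := by
  obtain ⟨x, p, h, hV⟩ := QBH.exists_gappedPair hxp hs hgap
  have hxx := h.left_pos
  have hpp := h.symm.left_pos
  have hΓ := (Q.Γ_eq_harmonicΓ hxp (QBH.X_mul_P_pos hxp hs hgap)).trans (h.harmonicΓ_eq hV)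
  obtain ⟨hξ0, hdecay⟩ := hξ
  set w := Real.exp (-1 / ξ) with hw
  have hw0 : 0 ≤ w := (Real.exp_pos _).le
  have hw1 : w < 1 := Real.exp_lt_one_iff.mpr (div_neg_of_neg_of_pos (by norm_num) hξ0)
  have hκ (r : Site (d + 1)) :
      |coeff (fun k => √(x k / p k)) r| ≤ c * H.normHxx / H.kreinGap * w ^ len r := by
    have hr := (hdecay r 0).2
    rw [hΓ, Matrix.fromBlocks_apply₂₂, Matrix.of_apply, sub_zero] at hr
    rwa [hw, ← Real.exp_nat_mul, mul_div_assoc', mul_neg_one]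
  have hLi : 0 ≤ polylog (1 - 2 * ((d + 1 : ℕ) : ℤ)) w := polylog_nonneg hw0
  have hc0 : 0 < c := lt_of_lt_of_le (by positivity) hc
  rw [entanglementEntropy, hΓ, restrict_fromBlocks_coeff]
  refine (h.sum_modeEntropy_le B hw0 hw1 hκ).trans ?_
  set L := polylog (1 - 2 * ((d + 1 : ℕ) : ℤ)) w
  calc 3 / 2 * (2 * H.normHpp / H.kreinGap * (c * H.normHxx / H.kreinGap *
        (2 * 3 ^ d * area B * L)))
      = 6 * (3 ^ d) * c * (H.normHxx * H.normHpp) * L * area B / H.kreinGap ^ 2 := by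
        field_simp
        ring
    _ ≤ 16 * c * c * (H.normHxx * H.normHpp) * L * area B / H.kreinGap ^ 2 := by
        gcongr
        norm_num
    _ = 16 * c ^ 2 * (H.normHxx * H.normHpp) * L * area B / H.kreinGap ^ 2 := by ring

end QBH.Bogoliubov

end Krein

end

theorem mainTheorem7 (D : ℕ) (hD : 1 ≤ D) :
    ∃ c : ℝ, 0 < c ∧ ∀ (R : ℕ) (H : Krein.QBH D R), 1 ≤ R →
      H.DynamicallyStable → 0 < H.kreinGap → H.Hxp + H.Hxpᵀ = 0 →
      (∀ k, H.X k ≠ 0 ∧ H.P k ≠ 0 ∧ 0 < H.X k / H.P k) ∧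
      Nonempty H.Bogoliubov ∧
      ∀ Q : H.Bogoliubov,
        Q.Γ = Krein.harmonicΓ (fun k => H.X k / H.P k) ∧
        Krein.IsCorrelationLength Q c
          (c * R * Real.sqrt (H.normHxx * H.normHpp) / H.kreinGap) ∧
        ∀ ξ : ℝ, Krein.IsCorrelationLength Q c ξ → ∀ B : Finset (Krein.Site D),
          Krein.entanglementEntropy Q.Γ B ≤
            16 * c ^ 2 * (H.normHxx * H.normHpp) *
              Krein.polylog (1 - 2 * (D : ℤ)) (Real.exp (-1 / ξ)) *
              (Krein.area B : ℝ) / H.kreinGap ^ 2 := by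
  obtain ⟨d, rfl⟩ := Nat.exists_eq_add_of_le' hD
  refine ⟨16 + 3 ^ d, by positivity, fun R H hR hs hgap hxp => ?_⟩
  have hpos := Krein.QBH.X_mul_P_pos hxp hs hgap
  refine ⟨fun k => ⟨left_ne_zero_of_mul (hpos k).ne', right_ne_zero_of_mul (hpos k).ne',
    div_pos_iff.mpr (mul_pos_iff.mp (hpos k))⟩, Krein.QBH.nonempty_bogoliubov hxp hpos,
    fun Q => ⟨Q.Γ_eq_harmonicΓ hxp hpos, ?_, fun ξ hξ B => ?_⟩⟩
  · exact Q.isCorrelationLength hR (le_add_of_nonneg_right (by positivity)) hs hgap hxp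
  · exact Q.entanglementEntropy_le (le_add_of_nonneg_left (by norm_num)) hs hgap hxp hξ B
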